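/- Let $\mathcal C$ be a small category and $k$ a field. For a small category $\mathcal D$ let $\mathrm{Ext}^*_{k\mathcal D}$ denote Ext in the abelian category of functors $\mathcal D\to Vect_k$, let $\underline k$ be the constant functor with value $k$, and regard $\mathrm{Ext}^*_{k\mathcal D}(M,M)=\bigoplus_{n\ge 0}\mathrm{Ext}^n_{k\mathcal D}(M,M)$ as a graded $k$-algebra with the Yoneda product. Let $\mathcal C^e=\mathcal C\times\mathcal C^{op}$, and let $k\mathcal C:\mathcal C^e\to Vect_k$ be the functor $(x,y)\mapsto k\,\mathrm{Hom}_{\mathcal C}(y,x)$. Let $F(\mathcal C)$ be Quillen's category of factorizations: its objects $[\alpha]$ are the morphisms $\alpha$ of $\mathcal C$, and a morphism $[\alpha]\to[\alpha']$ is a pair $(u,v)$ with $\alpha'=u\alpha v$. Let $t:F(\mathcal C)\to\mathcal C$ be the target functor, $\tau=(\text{target},\text{source}):F(\mathcal C)\to\mathcal C^e$, and $pr:\mathcal C^e\to\mathcal C$ the first projection. The left Kan extensions along $\tau$, $t$, $pr$, with the canonical identifications $LK_\tau\underline k\cong k\mathcal C$, $LK_t\underline k\cong\underline k$, $LK_{pr}(k\mathcal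 C)\cong\underline k$, turn projective resolutions of $\underline k$, $\underline k$, $k\mathcal C$ respectively into projective resolutions of $k\mathcal C$, $\underline k$, $\underline k$, and so induce homomorphisms of graded $k$-algebras $$\tau^*:\mathrm{Ext}^*_{kF(\mathcal C)}(\underline k,\underline k)\to\mathrm{Ext}^*_{k\mathcal C^e}(k\mathcal C,k\mathcal C),\quad t^*:\mathrm{Ext}^*_{kF(\mathcal C)}(\underline k,\underline k)\to\mathrm{Ext}^*_{k\mathcal C}(\underline k,\underline k),\quad pr^*:\mathrm{Ext}^*_{k\mathcal C^e}(k\mathcal C,k\mathcal C)\to\mathrm{Ext}^*_{k\mathcal C}(\underline k,\underline k),$$ of which $t^*$ is an isomorphism. Likewise $-\otimes_{k\mathcal C}\underline k$, with $k\mathcal C\otimes_{k\mathcal C}\underline k\cong\underline k$, turns projective resolutions of $k\mathcal C$ into exact complexes over $\underline k$, and so induces a homomorphism of graded $k$-algebras $\phi_{\mathcal C}:\mathrm{Ext}^*_{k\mathcal C^e}(k\mathcal C,k\mathcal C)\to\mathrm{Ext}^*_{k\mathcal C}(\underline k,\underline k)$. There exists a homomorphism of graded $k$-algebras $\epsilon^*:\mathrm{Ext}^*_{k\mathcal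 C^e}(k\mathcal C,k\mathcal C)\to\mathrm{Ext}^*_{kF(\mathcal C)}(\underline k,\underline k)$ such that $\epsilon^*\tau^*=1$ and $t^*\epsilon^*=pr^*=\phi_{\mathcal C}$. Moreover $\phi_{\mathcal C}$, from the Hochschild cohomology ring of $\mathcal C$ to its ordinary cohomology ring, is a split surjection: it is surjective, and there is a homomorphism of graded $k$-algebras $\sigma$ with $\phi_{\mathcal C}\sigma=1$. -/

import Mathlib

open CategoryTheory CategoryTheory.Limits CategoryTheory.Abelian Opposite
open scoped DirectSum MonoidalCategory

universe u

noncomputable section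

namespace CatCohomology

/-! ### The graded algebra `Ext^*(M, M)` -/

section ExtAlgebra

variable {A : Type*} [Category A] [Abelian A] [HasExt.{u} A]

/-- The Yoneda product on `Ext^*(M, M)`. In degree `0` it is composition of endomorphisms:
`x * y` is `y` followed by `x` (Mathlib's `Ext.comp` is in diagrammatic order). -/
instance extGMul (M : A) : GradedMonoid.GMul (fun n : ℕ => Ext.{u} M M n) where
  mul {i j} x y := y.comp x (add_comm j i)

instance extGOne (M : A) : GradedMonoid.GOne (fun n : ℕ => Ext.{u} M M n) where
  one := Ext.mk₀ (𝟙 M)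

theorem mk_ext_comp_congr {M : A} {a b c c' : ℕ} (x : Ext.{u} M M a) (y : Ext.{u} M M b)
    (h : a + b = c) (h' : a + b = c') :
    (GradedMonoid.mk c (x.comp y h) : GradedMonoid (fun n : ℕ => Ext.{u} M M n)) =
      GradedMonoid.mk c' (x.comp y h') := by
  subst h; subst h'; rfl

theorem mk_ext_id_comp {M : A} {a c : ℕ} (x : Ext.{u} M M a) (h : 0 + a = c) :
    (GradedMonoid.mk c ((Ext.mk₀ (𝟙 M)).comp x h) : GradedMonoid (fun n : ℕ => Ext.{u} M M n)) =
      GradedMonoid.mk a x := by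
  obtain rfl : a = c := by omega
  simp

theorem mk_ext_comp_id {M : A} {a c : ℕ} (x : Ext.{u} M M a) (h : a + 0 = c) :
    (GradedMonoid.mk c (x.comp (Ext.mk₀ (𝟙 M)) h) : GradedMonoid (fun n : ℕ => Ext.{u} M M n)) =
      GradedMonoid.mk a x := by
  obtain rfl : a = c := by omega
  simp

instance extGRing (M : A) : DirectSum.GRing (fun n : ℕ => Ext.{u} M M n) where
  mul_zero {i j} x := Ext.zero_comp (X := M) (Y := M) (Z := M) (n := j) x (i + j) (add_comm j i)
  zero_mul {i j} x := Ext.comp_zero (X := M) (Y := M) x M i (i + j) (add_comm j i)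
  mul_add _ _ _ := Ext.add_comp _ _ _ _
  add_mul _ _ _ := Ext.comp_add _ _ _ _
  one_mul := fun ⟨_, x⟩ => mk_ext_comp_id x _
  mul_one := fun ⟨_, x⟩ => mk_ext_id_comp x _
  mul_assoc := fun ⟨a, x⟩ ⟨b, y⟩ ⟨c, z⟩ => by
    change GradedMonoid.mk (a + b + c) (z.comp (y.comp x (add_comm b a)) (add_comm c (a + b))) =
      GradedMonoid.mk (a + (b + c)) ((z.comp y (add_comm c b)).comp x (add_comm (b + c) a))
    rw [Ext.comp_assoc z y x (add_comm c b) (add_comm b a) (by omega : c + b + a = a + (b + c))]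
    exact mk_ext_comp_congr _ _ _ _
  natCast n := n • Ext.mk₀ (𝟙 M)
  natCast_zero := zero_smul _ _
  natCast_succ n := succ_nsmul _ n
  intCast n := n • Ext.mk₀ (𝟙 M)
  intCast_ofNat n := natCast_zsmul _ n
  intCast_negSucc_ofNat n := negSucc_zsmul _ n

instance extGAlgebra (k : Type u) [Field k] [Linear k A] (M : A) :
    DirectSum.GAlgebra k (fun n : ℕ => Ext.{u} M M n) where
  toFun := AddMonoidHom.mk' (fun r => r • Ext.mk₀ (𝟙 M)) (fun r s => add_smul r s _)
  map_one := one_smul _ _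
  map_mul r s := by
    change GradedMonoid.mk 0 ((r * s) • Ext.mk₀ (𝟙 M)) =
      GradedMonoid.mk (0 + 0) ((s • Ext.mk₀ (𝟙 M)).comp (r • Ext.mk₀ (𝟙 M)) (add_comm 0 0))
    simp [mul_smul]
  commutes r := fun ⟨n, x⟩ => by
    change GradedMonoid.mk (0 + n) (x.comp (r • Ext.mk₀ (𝟙 M)) (add_comm n 0)) =
      GradedMonoid.mk (n + 0) ((r • Ext.mk₀ (𝟙 M)).comp x (add_comm 0 n))
    rw [Ext.comp_smul, Ext.smul_comp, ← Ext.smul_comp, ← Ext.comp_smul]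
    exact (mk_ext_comp_id (r • x) _).trans (mk_ext_id_comp (r • x) _).symm
  smul_def r := fun ⟨n, x⟩ => by
    change GradedMonoid.mk n (r • x) =
      GradedMonoid.mk (0 + n) (x.comp (r • Ext.mk₀ (𝟙 M)) (add_comm n 0))
    rw [Ext.comp_smul, ← Ext.smul_comp]
    exact (mk_ext_comp_id (r • x) _).symm

/-- The graded ring `Ext^*(M, M) = ⨁ n, Ext^n(M, M)` with the Yoneda product. -/
abbrev ExtAlg (M : A) : Type u := ⨁ n : ℕ, Ext.{u} M M n

/-- The homogeneous element of `Ext^*(M, M)` given by a class of degree `n`. -/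
abbrev homog {M : A} (n : ℕ) (x : Ext.{u} M M n) : ExtAlg M :=
  DirectSum.of (fun n : ℕ => Ext.{u} M M n) n x

/-- A map between `Ext`-algebras preserving degrees. -/
def IsGraded {B : Type*} [Category B] [Abelian B] [HasExt.{u} B] {M : A} {N : B}
    (Φ : ExtAlg M → ExtAlg N) : Prop :=
  ∀ (n : ℕ) (x : Ext.{u} M M n), ∃ y : Ext.{u} N N n, Φ (homog n x) = homog n y

end ExtAlgebra

/-! ### Maps on `Ext` induced by applying a functor to projective resolutions -/

section Induced

variable {A B : Type*} [Category A] [Abelian A] [Category B] [Abelian B]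
  (L : A ⥤ B) [L.PreservesZeroMorphisms] {M : A} {M' : B} (m : L.obj M ⟶ M')

/-- For a resolution `P → M`, the augmented complex `L(P) → L(M) → M'`. -/
def augmentation (P : ProjectiveResolution M) :
    (L.mapHomologicalComplex (ComplexShape.down ℕ)).obj P.complex ⟶
      (ChainComplex.single₀ B).obj M' :=
  (L.mapHomologicalComplex _).map P.π ≫
    (HomologicalComplex.singleMapHomologicalComplex L (ComplexShape.down ℕ) 0).hom.app M ≫
      (ChainComplex.single₀ B).map m

theorem induced_cocycle {P : ProjectiveResolution M} {Q : ProjectiveResolution M'}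
    (c : Q.complex ⟶ (L.mapHomologicalComplex (ComplexShape.down ℕ)).obj P.complex)
    {n : ℕ} {f : P.complex.X n ⟶ M} (hf : P.complex.d (n + 1) n ≫ f = 0) :
    Q.complex.d (n + 1) n ≫ (c.f n ≫ L.map f ≫ m : Q.complex.X n ⟶ M') = 0 := by
  have h := c.comm (n + 1) n
  have h2 : L.map (P.complex.d (n + 1) n) ≫ L.map f = 0 := by
    rw [← L.map_comp, hf, L.map_zero]
  rw [← Category.assoc, ← h]
  have h3 : L.map (P.complex.d (n + 1) n) ≫ L.map f ≫ m = 0 := by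
    rw [← Category.assoc, h2, zero_comp]
  rw [Category.assoc]
  exact (congrArg (fun g => c.f (n + 1) ≫ g) h3).trans comp_zero

/-- `Φ : Ext^*(M, M) → Ext^*(M', M')` is the map induced by `L` and the identification
`m : L(M) ≅ M'`: for every projective resolution `P → M` the complex `L(P) → L(M) ≅ M'` is exact,
and if `Q → M'` is a projective resolution and `c : Q → L(P)` a chain map over `M'`,
then `Φ` sends the class of a cocycle `f : P_n → M` to the class of
`Q_n → L(P_n) → L(M) ≅ M'`. (If `L` preserves projectives, one can take `Q = L(P)`, `c = id`.) -/
structure IsInducedBy [HasExt.{u} A] [HasExt.{u} B] (Φ : ExtAlg M → ExtAlg M') : Prop where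
  isIso : IsIso m
  quasiIso (P : ProjectiveResolution M) : QuasiIso (augmentation L m P)
  map_add (x y : ExtAlg M) : Φ (x + y) = Φ x + Φ y
  map_class (P : ProjectiveResolution M) (Q : ProjectiveResolution M')
    (c : Q.complex ⟶ (L.mapHomologicalComplex (ComplexShape.down ℕ)).obj P.complex)
    (hc : c ≫ augmentation L m P = Q.π) (n : ℕ) (f : P.complex.X n ⟶ M)
    (hf : P.complex.d (n + 1) n ≫ f = 0) :
    Φ (homog n (P.extMk f (n + 1) rfl hf)) =
      homog n (Q.extMk (c.f n ≫ L.map f ≫ m) (n + 1) rfl (induced_cocycle L m c hf))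

end Induced

/-! ### Functors from a small category to vector spaces -/

section Functors

variable (k : Type u) [Field k] (C : Type u) [SmallCategory C]

instance : EnoughProjectives (C ⥤ ModuleCat.{u} k) where
  presentation F := by
    let G : C → (C ⥤ ModuleCat.{u} k) := fun c =>
      (evaluationLeftAdjoint (ModuleCat.{u} k) c).obj (F.obj c)
    have hG (c : C) : Projective (G c) :=
      (evaluationAdjunctionRight (ModuleCat.{u} k) c).map_projective _
        (IsProjective.iff_projective (F.obj c) |>.1 inferInstance)
    let p : ∐ G ⟶ F := Sigma.desc fun c =>
      (evaluationAdjunctionRight (ModuleCat.{u} k) c).counit.app F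
    have hp : Epi p := by
      have h0 (c : C) : @Epi (ModuleCat.{u} k) _ _ _ (p.app c) := by
        have h1 := (evaluationAdjunctionRight (ModuleCat.{u} k) c).right_triangle_components F
        have h2 : Sigma.ι G c ≫ p = (evaluationAdjunctionRight (ModuleCat.{u} k) c).counit.app F :=
          Sigma.ι_desc _ _
        have h3 : ((evaluationAdjunctionRight (ModuleCat.{u} k) c).unit.app (F.obj c) ≫
          (Sigma.ι G c).app c) ≫ p.app c = 𝟙 (F.obj c) := by
          rw [Category.assoc, ← NatTrans.comp_app, h2]
          exact h1
        exact epi_of_epi_fac h3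
      exact (NatTrans.epi_iff_epi_app p).2 h0
    exact ⟨{ p := ∐ G, f := p }⟩

instance : HasExt.{u} (C ⥤ ModuleCat.{u} k) := hasExt_of_enoughProjectives.{u} _

/-- The trivial module: the constant functor with value `k`. -/
abbrev triv : C ⥤ ModuleCat.{u} k := (Functor.const C).obj (ModuleCat.of k k)

/-- The functor `kC` on the enveloping category `C × Cᵒᵖ`: `(x, y) ↦ k Hom(y, x)`, where
`(u, v)` acts on a basis element `f` by `f ↦ u ∘ f ∘ v`. -/
def bimod : C × Cᵒᵖ ⥤ ModuleCat.{u} k where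
  obj p := ModuleCat.of k ((p.2.unop ⟶ p.1) →₀ k)
  map g := ModuleCat.ofHom (Finsupp.lmapDomain k k (fun f => g.2.unop ≫ f ≫ g.1))
  map_id p := by
    ext f
    simp
  map_comp g h := by
    ext f
    simp

/-- Quillen's category of factorizations `F(C)`: the objects `[α]` are the morphisms of `C`. -/
structure FactCat where
  src : C
  tgt : C
  arr : src ⟶ tgt

namespace FactCat

variable {C}

/-- A morphism `[α] ⟶ [α']` is a pair `(u, v)` with `α' = u ∘ α ∘ v`. -/
@[ext]
structure Hom (a b : FactCat C) where
  u : a.tgt ⟶ b.tgt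
  v : b.src ⟶ a.src
  w : v ≫ a.arr ≫ u = b.arr

instance : SmallCategory (FactCat C) where
  Hom := Hom
  id a := ⟨𝟙 _, 𝟙 _, by simp⟩
  comp f g := ⟨f.u ≫ g.u, g.v ≫ f.v, by rw [← g.w, ← f.w]; simp⟩
  id_comp _ := by ext <;> simp
  comp_id _ := by ext <;> simp
  assoc _ _ _ := by ext <;> simp

variable (C)

/-- The target functor `t : F(C) ⥤ C`. -/
def t : FactCat C ⥤ C where
  obj a := a.tgt
  map f := f.u

/-- The source functor `s : F(C) ⥤ Cᵒᵖ`. -/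
def s : FactCat C ⥤ Cᵒᵖ where
  obj a := op a.src
  map f := f.v.op

/-- The functor `τ = (t, s) : F(C) ⥤ C × Cᵒᵖ`. -/
abbrev τ : FactCat C ⥤ C × Cᵒᵖ := (t C).prod' (s C)

/-- The projection `pr : C × Cᵒᵖ ⥤ C`. -/
abbrev pr : C × Cᵒᵖ ⥤ C := CategoryTheory.Prod.fst C Cᵒᵖ

end FactCat

variable {k C}

/-- The morphism `LK_θ(M) ⟶ M'` adjoint to `j : M ⟶ Res_θ(M')`. -/
def lanDesc {D : Type u} [SmallCategory D] (θ : C ⥤ D) {M : C ⥤ ModuleCat.{u} k}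
    {M' : D ⥤ ModuleCat.{u} k} (j : M ⟶ θ ⋙ M') : θ.lan.obj M ⟶ M' :=
  ((θ.lanAdjunction (ModuleCat.{u} k)).homEquiv M M').symm j

variable (k C)

/-- `ι : k ⟶ Res_τ(kC)`, `1 ↦ α` at `[α]`. -/
def unitTau : triv k (FactCat C) ⟶ FactCat.τ C ⋙ bimod k C where
  app a := ModuleCat.ofHom
    (LinearMap.toSpanSingleton k ((a.src ⟶ a.tgt) →₀ k) (Finsupp.single a.arr 1))
  naturality a b f := by
    refine ModuleCat.hom_ext (LinearMap.ext_ring ?_)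
    change (1 : k) • Finsupp.single b.arr (1 : k) =
      Finsupp.mapDomain (fun g => f.v ≫ g ≫ f.u) ((1 : k) • Finsupp.single a.arr (1 : k))
    rw [one_smul, one_smul, Finsupp.mapDomain_single, f.w]

/-- The identity `k = Res_t(k)`. -/
def unitT : triv k (FactCat C) ⟶ FactCat.t C ⋙ triv k C where
  app _ := 𝟙 _

/-- `kC ⟶ Res_pr(k)`, sending each basis element to `1`. -/
def unitPr : bimod k C ⟶ FactCat.pr C ⋙ triv k C where
  app p := ModuleCat.ofHom
    (Finsupp.linearCombination k (fun _ : p.2.unop ⟶ p.1 => (1 : k)))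
  naturality p q f := by
    refine ModuleCat.hom_ext (Finsupp.lhom_ext' fun g => LinearMap.ext_ring ?_)
    change Finsupp.linearCombination k (fun _ => (1 : k))
        (Finsupp.mapDomain (fun g => f.2.unop ≫ g ≫ f.1) (Finsupp.single g (1 : k))) =
      Finsupp.linearCombination k (fun _ => (1 : k)) (Finsupp.single g (1 : k))
    rw [Finsupp.mapDomain_single, Finsupp.linearCombination_single,
      Finsupp.linearCombination_single]

variable {k C}

/-- For a right module `X : Cᵒᵖ ⥤ Vect` and a left module `N : C ⥤ Vect`, the bifunctor
`(y', y) ↦ X(y') ⊗_k N(y)`. -/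
def tensorBif (N : C ⥤ ModuleCat.{u} k) :
    (Cᵒᵖ ⥤ ModuleCat.{u} k) ⥤ (Cᵒᵖ ⥤ C ⥤ ModuleCat.{u} k) :=
  (Functor.whiskeringRight _ _ _).obj (MonoidalCategory.curriedTensor (ModuleCat.{u} k) ⋙
    (Functor.whiskeringLeft _ _ _).obj N)

/-- The tensor product over `kC` of the `kC^e`-module `M` and the `kC`-module `N`:
`(M ⊗_{kC} N)(x)` is the coend of `M(x, y) ⊗_k N(y)` over `y`, i.e. the quotient of
`⨁ y, M(x, y) ⊗_k N(y)` by the relations `m β ⊗ n = m ⊗ β n` for `β : y ⟶ y'`,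
`m ∈ M(x, y')`, `n ∈ N(y)`. -/
def tensorObj (N : C ⥤ ModuleCat.{u} k) (M : C × Cᵒᵖ ⥤ ModuleCat.{u} k) :
    C ⥤ ModuleCat.{u} k where
  obj x := coend ((tensorBif N).obj ((Functor.curry.obj M).obj x))
  map g := coend.map ((tensorBif N).map ((Functor.curry.obj M).map g))
  map_id x := by
    rw [CategoryTheory.Functor.map_id, CategoryTheory.Functor.map_id, coend.map_id]
  map_comp g h := by
    rw [CategoryTheory.Functor.map_comp, CategoryTheory.Functor.map_comp, coend.map_comp]

/-- The map `φ ⊗_{kC} N`. -/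
def tensorMap (N : C ⥤ ModuleCat.{u} k) {M M' : C × Cᵒᵖ ⥤ ModuleCat.{u} k} (φ : M ⟶ M') :
    tensorObj N M ⟶ tensorObj N M' where
  app x := coend.map ((tensorBif N).map ((Functor.curry.map φ).app x))
  naturality x x' g := by
    change coend.map _ ≫ coend.map _ = coend.map _ ≫ coend.map _
    rw [coend.map_comp, coend.map_comp, ← CategoryTheory.Functor.map_comp,
      ← CategoryTheory.Functor.map_comp, NatTrans.naturality]

/-- The functor `- ⊗_{kC} N`. -/
def tensorOver (N : C ⥤ ModuleCat.{u} k) :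
    (C × Cᵒᵖ ⥤ ModuleCat.{u} k) ⥤ (C ⥤ ModuleCat.{u} k) where
  obj M := tensorObj N M
  map φ := tensorMap N φ
  map_id M := by
    ext x : 2
    change coend.map ((tensorBif N).map ((Functor.curry.map (𝟙 M)).app x)) = 𝟙 (coend _)
    rw [CategoryTheory.Functor.map_id, NatTrans.id_app, CategoryTheory.Functor.map_id,
      coend.map_id]
  map_comp φ ψ := by
    ext x : 2
    change coend.map ((tensorBif N).map ((Functor.curry.map (φ ≫ ψ)).app x)) =
      coend.map _ ≫ coend.map _
    rw [coend.map_comp, CategoryTheory.Functor.map_comp, NatTrans.comp_app,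
      CategoryTheory.Functor.map_comp]

instance {D : Type u} [SmallCategory D] (θ : C ⥤ D) :
    (θ.lan : (C ⥤ ModuleCat.{u} k) ⥤ (D ⥤ ModuleCat.{u} k)).PreservesZeroMorphisms :=
  have : (θ.lan : (C ⥤ ModuleCat.{u} k) ⥤ (D ⥤ ModuleCat.{u} k)).IsLeftAdjoint :=
    (θ.lanAdjunction (ModuleCat.{u} k)).isLeftAdjoint
  inferInstance

instance (N : C ⥤ ModuleCat.{u} k) : (tensorOver N).PreservesZeroMorphisms where
  map_zero X Y := by
    ext x : 2
    refine coend.hom_ext fun y => ?_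
    refine (coend.ι_map _ _).trans ?_
    have h : (((tensorBif N).map ((Functor.curry.map (0 : X ⟶ Y)).app x)).app (op y)).app y = 0 :=
      MonoidalPreadditive.zero_whiskerRight
    rw [h]
    exact zero_comp.trans comp_zero.symm

/-- The map `k Hom(y, x) ⊗_k N(y) ⟶ N(x)`, `f ⊗ n ↦ f n`. -/
def tensorAct (N : C ⥤ ModuleCat.{u} k) (x y : C) :
    (((tensorBif N).obj ((Functor.curry.obj (bimod k C)).obj x)).obj (op y)).obj y ⟶ N.obj x :=
  ModuleCat.ofHom (TensorProduct.lift
    (Finsupp.linearCombination k (fun f : y ⟶ x => (N.map f).hom)) :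
      TensorProduct k ((y ⟶ x) →₀ k) (N.obj y) →ₗ[k] N.obj x)

theorem tensorAct_dinatural (N : C ⥤ ModuleCat.{u} k) (x : C) {i j : C} (g : i ⟶ j) :
    (((tensorBif N).obj ((Functor.curry.obj (bimod k C)).obj x)).map g.op).app i ≫
        tensorAct N x i =
      (((tensorBif N).obj ((Functor.curry.obj (bimod k C)).obj x)).obj (op j)).map g ≫
        tensorAct N x j := by
  refine ModuleCat.hom_ext (TensorProduct.ext (Finsupp.lhom_ext' fun f =>
    LinearMap.ext_ring (LinearMap.ext fun n => ?_)))
  change Finsupp.linearCombination k (fun f : i ⟶ x => (N.map f).hom)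
      (Finsupp.mapDomain (fun f => g ≫ f ≫ 𝟙 x) (Finsupp.single f (1 : k))) n =
    Finsupp.linearCombination k (fun f : j ⟶ x => (N.map f).hom)
      (Finsupp.single f (1 : k)) ((N.map g).hom n)
  rw [Finsupp.mapDomain_single, Finsupp.linearCombination_single,
    Finsupp.linearCombination_single]
  simp

theorem tensorAct_natural (N : C ⥤ ModuleCat.{u} k) {x x' : C} (g : x ⟶ x') (y : C) :
    (((tensorBif N).map ((Functor.curry.obj (bimod k C)).map g)).app (op y)).app y ≫
        tensorAct N x' y =
      tensorAct N x y ≫ N.map g := by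
  refine ModuleCat.hom_ext (TensorProduct.ext (Finsupp.lhom_ext' fun f =>
    LinearMap.ext_ring (LinearMap.ext fun n => ?_)))
  change Finsupp.linearCombination k (fun f : y ⟶ x' => (N.map f).hom)
      (Finsupp.mapDomain (fun f => 𝟙 y ≫ f ≫ g) (Finsupp.single f (1 : k))) n =
    (N.map g).hom (Finsupp.linearCombination k (fun f : y ⟶ x => (N.map f).hom)
      (Finsupp.single f (1 : k)) n)
  rw [Finsupp.mapDomain_single, Finsupp.linearCombination_single,
    Finsupp.linearCombination_single]
  simp

/-- The canonical map `kC ⊗_{kC} N ⟶ N`, `f ⊗ n ↦ f n`. -/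
def tensorDesc (N : C ⥤ ModuleCat.{u} k) : (tensorOver N).obj (bimod k C) ⟶ N where
  app x := coend.desc (tensorAct N x) (fun _ _ g => tensorAct_dinatural N x g)
  naturality x x' g := by
    refine coend.hom_ext fun y => ?_
    refine (coend.ι_map_assoc _ _ _).trans ?_
    refine (congrArg (fun p => _ ≫ p) (coend.ι_desc _ _ _)).trans ?_
    exact (tensorAct_natural N g y).trans (coend.ι_desc_assoc _ _ _ _).symm

end Functors

end CatCohomology

end

open CatCohomology

noncomputable section

attribute [-instance] catToReflQuiver

namespace CatCohomology

/-! ### Exact functors on `Ext` and projective resolutions -/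

section ExactFunctor

open CochainComplex HomComplex

/-! Each of the three homomorphisms comes from an adjunction `L ⊣ R` with `R` exact and a morphism
`j : M ⟶ R(M')` adjoint to an isomorphism `m : L(M) ≅ M'`. If `L` keeps projective resolutions `P →
M` exact, then `L(P)` is a projective resolution of `M'`, and the adjunction identifies the cochains
`Hom(L(P), Y)` with `Hom(P, R(Y))`. Hence `y ↦ R(y) ∘ j` is a bijection from `Ext(M', Y)` to `Ext(M,
R(Y))` (`extRestrict_bijective`), and the induced map sends `x` to the unique `y` with `R(y) ∘ j = j
∘ x`. In this form it depends only on `R` and `j`, is visibly multiplicative, and is bijective when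
`j` is invertible.

Since only `R` matters, each abstract Kan extension may be replaced by a convenient left adjoint.
Along `τ` this is a direct sum over the morphisms `α : y ⟶ x`, which is exact. Along `pr` it is `-
⊗_{kC} k`, so `pr^* = φ_C`; it need not be exact, but each `kC(x, -) = k Hom(-, x)` is projective,
so resolutions of `kC` split after evaluation at `x` and stay exact (`isAcyclicAt_tensorOver`).
Along `t` it is the composite of the two, as `t = pr ∘ τ`.

Therefore `t^* = pr^* τ^*` (`tAlgEquiv_apply`), and `t^*` is an isomorphism because its `j` is an
identity. The maps sought are `ε^* = (t^*)⁻¹ pr^*` and `σ = τ^* (t^*)⁻¹`. -/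

theorem comp_map_conj {A B : Type*} [Category A] [Category B] (R : B ⥤ A)
    {a a' m m₁ n₁ : A} {b b' m' m₁' : B} (e : a ≅ a') (δ : a' ⟶ R.obj b')
    (e' : b ≅ b') (p' : b' ⟶ m') (s' : m₁' ≅ m') (t : n₁ ≅ R.obj m') (p : a' ⟶ m) (s : m₁ ≅ m)
    (j : m ⟶ R.obj m') (h : δ ≫ R.map p' = p ≫ j) :
    (e.hom ≫ δ ≫ R.map e'.inv) ≫ R.map (e'.hom ≫ p' ≫ s'.inv) ≫ R.map s'.hom ≫ t.inv =
      (e.hom ≫ p ≫ s.inv) ≫ s.hom ≫ j ≫ t.inv := by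
  simp only [Category.assoc, Iso.inv_hom_id_assoc, ← reassoc_of% h, ← R.map_comp_assoc,
    Iso.inv_hom_id, Category.comp_id]

theorem comp_map_conj' {A B : Type*} [Category A] [Category B] (R : B ⥤ A) {a a' n₁ : A}
    {b b' y y₁ y₂ : B} (e : a ≅ a') (δ : a' ⟶ R.obj b') (e' : b ≅ b') (g : b' ⟶ y) (s : y₁ ≅ y)
    (x : y₂ ≅ y₁) (t : n₁ ≅ R.obj y) :
    (e.hom ≫ δ ≫ R.map e'.inv) ≫ R.map (((e'.hom ≫ g) ≫ s.inv) ≫ x.inv) ≫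
      R.map x.hom ≫ R.map s.hom ≫ t.inv = (e.hom ≫ δ ≫ R.map g) ≫ t.inv := by
  simp only [Category.assoc, ← R.map_comp_assoc, Iso.inv_hom_id, Iso.inv_hom_id_assoc,
    Category.comp_id]

theorem comp_assoc₄ {A : Type*} [Category A] {a b c d e f : A} (p : a ⟶ b) (q : b ⟶ c)
    (r : c ⟶ d) (s : d ⟶ e) (t : e ⟶ f) :
    p ≫ q ≫ r ≫ s ≫ t = (p ≫ q ≫ r ≫ s) ≫ t := by
  simp only [Category.assoc]

variable {A B : Type*} [Category A] [Abelian A] [Category B] [Abelian B]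
  (R : B ⥤ A) {M : A} {M' : B}
  {P : ProjectiveResolution M} {Q : ProjectiveResolution M'}
  (d : ∀ n, P.complex.X n ⟶ R.obj (Q.complex.X n))

open Classical in
/-- The components of `extendHom`. -/
def extendHomF (i : ℤ) : P.cochainComplex.X i ⟶ R.obj (Q.cochainComplex.X i) :=
  if hi : ∃ k : ℕ, -(k : ℤ) = i then
    (P.cochainComplexXIso i hi.choose hi.choose_spec).hom ≫ d hi.choose ≫
      R.map (Q.cochainComplexXIso i hi.choose hi.choose_spec).inv
  else
    (P.cochainComplex.isZero_of_isStrictlyLE 0 i (by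
      by_contra! h
      exact hi ⟨i.natAbs, by omega⟩)).to_ _

/-- The index given by `choose` is forced, since `k ↦ -k` is injective. It is replaced by
substitution because the isomorphisms depend on it. -/
theorem extendHomF_eq (i : ℤ) (k : ℕ) (hk : -(k : ℤ) = i) :
    extendHomF R d i = (P.cochainComplexXIso i k hk).hom ≫ d k ≫
      R.map (Q.cochainComplexXIso i k hk).inv := by
  have hi : ∃ k : ℕ, -(k : ℤ) = i := ⟨k, hk⟩
  have h : ∀ (l : ℕ) (hl : -(l : ℤ) = i), l = k → (P.cochainComplexXIso i l hl).hom ≫ d l ≫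
      R.map (Q.cochainComplexXIso i l hl).inv = (P.cochainComplexXIso i k hk).hom ≫ d k ≫
      R.map (Q.cochainComplexXIso i k hk).inv := by
    rintro l hl rfl
    rfl
  rw [extendHomF, dif_pos hi]
  exact h _ hi.choose_spec (by have := hi.choose_spec; omega)

variable {d} [R.Additive]

theorem extendHomF_comm
    (hd : ∀ n, d (n + 1) ≫ R.map (Q.complex.d (n + 1) n) = P.complex.d (n + 1) n ≫ d n) (i : ℤ) :
    extendHomF R d i ≫ R.map (Q.cochainComplex.d i (i + 1)) =
      P.cochainComplex.d i (i + 1) ≫ extendHomF R d (i + 1) := by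
  by_cases hi : i + 1 ≤ 0
  · obtain ⟨l, hl⟩ := Int.exists_eq_neg_ofNat hi
    have hk : -((l + 1 : ℕ) : ℤ) = i := by push_cast; omega
    rw [extendHomF_eq R d i (l + 1) hk, extendHomF_eq R d (i + 1) l hl.symm,
      P.cochainComplex_d i (i + 1) (l + 1) l hk hl.symm,
      Q.cochainComplex_d i (i + 1) (l + 1) l hk hl.symm]
    simp only [Category.assoc, Iso.inv_hom_id_assoc, ← reassoc_of% (hd l), ← R.map_comp]
  · exact (R.map_isZero (CochainComplex.isZero_of_isStrictlyLE Q.cochainComplex 0 (i + 1)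
        (by omega))).eq_of_tgt _ _

/-- The extension to cochain complexes indexed by `ℤ` of a morphism `P → R(Q)`. -/
def extendHom
    (hd : ∀ n, d (n + 1) ≫ R.map (Q.complex.d (n + 1) n) = P.complex.d (n + 1) n ≫ d n) :
    P.cochainComplex ⟶ (R.mapHomologicalComplex (ComplexShape.up ℤ)).obj Q.cochainComplex where
  f i := extendHomF R d i
  comm' i j hij := by
    obtain rfl : i + 1 = j := hij
    exact extendHomF_comm R hd i

theorem singleMap_hom_f (Y : B) :
    ((R.mapCochainComplexSingleFunctor 0).hom.app Y).f 0 =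
      R.map (HomologicalComplex.singleObjXSelf (.up ℤ) 0 Y).hom ≫
        (HomologicalComplex.singleObjXSelf (.up ℤ) 0 (R.obj Y)).inv :=
  HomologicalComplex.singleMapHomologicalComplex_hom_app_self R (ComplexShape.up ℤ) 0 Y

/-- The target is concentrated in degree 0, so compatibility with the augmentations reduces to `h0`.
-/
theorem extendHom_comp_map_π'
    (hd : ∀ n, d (n + 1) ≫ R.map (Q.complex.d (n + 1) n) = P.complex.d (n + 1) n ≫ d n)
    (j : M ⟶ R.obj M') (h0 : d 0 ≫ R.map (Q.π.f 0) = P.π.f 0 ≫ j) :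
    extendHom R hd ≫ (R.mapHomologicalComplex (ComplexShape.up ℤ)).map Q.π' ≫
        (R.mapCochainComplexSingleFunctor 0).hom.app M' =
      P.π' ≫ (CochainComplex.singleFunctor A 0).map j := by
  refine HomologicalComplex.to_single_hom_ext ?_
  have h1 : ((CochainComplex.singleFunctor A 0).map j).f 0 =
      (HomologicalComplex.singleObjXSelf (.up ℤ) 0 M).hom ≫ j ≫
        (HomologicalComplex.singleObjXSelf (.up ℤ) 0 (R.obj M')).inv :=
    HomologicalComplex.single_map_f_self _ 0 j
  have h2 : (extendHomF R d 0 ≫ R.map (Q.π'.f 0) ≫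
      ((R.mapCochainComplexSingleFunctor 0).hom.app M').f 0 : _ ⟶ _) =
      P.π'.f 0 ≫ ((CochainComplex.singleFunctor A 0).map j).f 0 := by
    rw [h1, singleMap_hom_f, extendHomF_eq R d 0 0 rfl, P.π'_f_zero, Q.π'_f_zero]
    exact comp_map_conj R _ _ _ _ _ _ _ _ _ h0
  exact h2


theorem equivHomShift_symm_f {K L : CochainComplex A ℤ} {n : ℤ} (z : Cocycle K L n) (i j : ℤ)
    (hij : i + n = j) :
    (Cocycle.equivHomShift.symm z).f i =
      z.1.v i j hij ≫ (L.shiftFunctorObjXIso n i j hij.symm).inv := by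
  subst hij
  simp [Cocycle.equivHomShift_symm_apply, Cochain.rightShift_v _ _ _ _ _ _ _ _ rfl]
  rfl

theorem to_single_shift_hom_ext {K : CochainComplex A ℤ} {Y : A} {n i : ℤ} (hi : i + n = 0)
    {f g : K ⟶ ((CochainComplex.singleFunctor A 0).obj Y)⟦n⟧} (h : f.f i = g.f i) : f = g := by
  ext l
  by_cases hl : l = i
  · subst hl; exact h
  · exact (HomologicalComplex.isZero_single_obj_X (ComplexShape.up ℤ) 0 Y (l + n)
      (by omega)).eq_of_tgt _ _


/-- The morphism in degree `n` from a resolution to `Y` given by a cocycle. -/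
def cocycleHom (P : ProjectiveResolution M) {Y : A} {n : ℕ} (f : P.complex.X n ⟶ Y)
    (hf : P.complex.d (n + 1) n ≫ f = 0) :
    ShiftedHom P.cochainComplex ((CochainComplex.singleFunctor A 0).obj Y) (n : ℤ) :=
  Cocycle.equivHomShift.symm (Cocycle.toSingleMk ((P.cochainComplexXIso (-n) n rfl).hom ≫ f)
    (by simp) (-(n + 1 : ℕ)) (by lia)
    (by simp only [P.cochainComplex_d _ _ (n + 1) n rfl rfl, Category.assoc,
          Iso.inv_hom_id_assoc, hf, comp_zero]))

theorem cocycleHom_f (P : ProjectiveResolution M) {Y : A} {n : ℕ} (f : P.complex.X n ⟶ Y)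
    (hf : P.complex.d (n + 1) n ≫ f = 0) :
    HomologicalComplex.Hom.f (cocycleHom P f hf) (-(n : ℤ)) =
      (((P.cochainComplexXIso (-n) n rfl).hom ≫ f) ≫
        (HomologicalComplex.singleObjXSelf (.up ℤ) 0 Y).inv) ≫
      (CochainComplex.shiftFunctorObjXIso ((CochainComplex.singleFunctor A 0).obj Y) n (-n) 0
        (by simp)).inv := by
  rw [cocycleHom, equivHomShift_symm_f _ _ 0 (by simp)]
  congr 1
  exact Cochain.toSingleMk_v _ _

theorem shift_map_f {K L : CochainComplex A ℤ} (φ : K ⟶ L) (n i j : ℤ) (h : j = i + n) :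
    (φ⟦n⟧').f i = (K.shiftFunctorObjXIso n i j h).hom ≫ φ.f j ≫
      (L.shiftFunctorObjXIso n i j h).inv := by
  subst h
  change φ.f (i + n) = 𝟙 _ ≫ φ.f (i + n) ≫ 𝟙 _
  rw [Category.id_comp, Category.comp_id]

theorem map_shiftFunctorObjXIso_hom (K : CochainComplex B ℤ) (n i j : ℤ) (h : j = i + n) :
    R.map (K.shiftFunctorObjXIso n i j h).hom =
      (CochainComplex.shiftFunctorObjXIso
        ((R.mapHomologicalComplex (ComplexShape.up ℤ)).obj K) n i j h).hom := by
  subst h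
  exact R.map_id _

/-- Both sides land in a complex concentrated in degree `-n`, so it is enough to compare that
component. -/
theorem extendHom_comp_cocycleHom
    (hd : ∀ n, d (n + 1) ≫ R.map (Q.complex.d (n + 1) n) = P.complex.d (n + 1) n ≫ d n)
    {Y : B} {n : ℕ} (g : Q.complex.X n ⟶ Y) (hg : Q.complex.d (n + 1) n ≫ g = 0)
    (hg' : P.complex.d (n + 1) n ≫ d n ≫ R.map g = 0) :
    (ShiftedHom.mk₀ (0 : ℤ) rfl (extendHom R hd)).comp
      (((cocycleHom Q g hg).map (R.mapHomologicalComplex (ComplexShape.up ℤ))).comp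
        (ShiftedHom.mk₀ (0 : ℤ) rfl ((R.mapCochainComplexSingleFunctor 0).hom.app Y)) (zero_add _))
        (add_zero _) =
      cocycleHom P (d n ≫ R.map g) hg' := by
  rw [ShiftedHom.comp_mk₀, ShiftedHom.mk₀_comp]
  refine to_single_shift_hom_ext (i := -n) (by simp) ?_
  refine Eq.trans ?_ (cocycleHom_f P (d n ≫ R.map g) hg').symm
  have h : (extendHomF R d (-n) ≫ R.map (HomologicalComplex.Hom.f (cocycleHom Q g hg) (-(n : ℤ))) ≫
      (R.map (CochainComplex.shiftFunctorObjXIso ((CochainComplex.singleFunctor B 0).obj Y) n (-n) 0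
        (by simp)).hom ≫ ((R.mapCochainComplexSingleFunctor 0).hom.app Y).f 0)) =
    (((P.cochainComplexXIso (-n) n rfl).hom ≫ (d n ≫ R.map g)) ≫
        (HomologicalComplex.singleObjXSelf (.up ℤ) 0 (R.obj Y)).inv) := by
    rw [cocycleHom_f, singleMap_hom_f, extendHomF_eq R d _ n rfl]
    exact comp_map_conj' R _ _ _ _ _ _ _
  rw [← h]
  -- The `𝟙 _` is the component of the commutation of `R` with the shift.
  change extendHomF R d (-n) ≫ (R.map (HomologicalComplex.Hom.f (cocycleHom Q g hg) (-(n : ℤ))) ≫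
    𝟙 _) ≫ (((R.mapCochainComplexSingleFunctor 0).hom.app Y)⟦(n : ℤ)⟧').f (-n) = _
  rw [shift_map_f _ _ _ 0 (by simp), map_shiftFunctorObjXIso_hom, Category.comp_id]
  exact comp_assoc₄ _ _ _ _ _


variable [PreservesFiniteLimits R] [PreservesFiniteColimits R]

theorem extMk_hom_eq [HasExt.{u} A] [HasDerivedCategory A] (P : ProjectiveResolution M) {Y : A} {n : ℕ}
    (f : P.complex.X n ⟶ Y) (hf : P.complex.d (n + 1) n ≫ f = 0) :
    (P.extMk f (n + 1) rfl hf).hom = (ShiftedHom.mk₀ (0 : ℤ) rfl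
      ((DerivedCategory.singleFunctorIsoCompQ A 0).hom.app M ≫
        inv (DerivedCategory.Q.map P.π'))).comp
      (((cocycleHom P f hf).map DerivedCategory.Q).comp
        (.mk₀ _ rfl ((DerivedCategory.singleFunctorIsoCompQ A 0).inv.app Y)) (zero_add _))
          (add_zero _) :=
  P.extMk_hom f (n + 1) rfl hf

/-- The chain map covers `j`, so in the derived category it represents `j` once the augmentations
are inverted. The image under `R` of the augmentation of the second resolution becomes invertible
there, and cancelling it leaves `extendHom_comp_map_π'`. -/
theorem inv_π'_comp_extendHom [HasDerivedCategory A] [HasDerivedCategory B]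
    (hd : ∀ n, d (n + 1) ≫ R.map (Q.complex.d (n + 1) n) = P.complex.d (n + 1) n ≫ d n)
    (j : M ⟶ R.obj M') (h0 : d 0 ≫ R.map (Q.π.f 0) = P.π.f 0 ≫ j) :
    (DerivedCategory.singleFunctor A 0).map j ≫
      (R.mapDerivedCategorySingleFunctor 0).inv.app M' ≫
      R.mapDerivedCategory.map ((DerivedCategory.singleFunctorIsoCompQ B 0).hom.app M' ≫
        inv (DerivedCategory.Q.map Q.π')) ≫
      R.mapDerivedCategoryFactors.hom.app Q.cochainComplex =
    ((DerivedCategory.singleFunctorIsoCompQ A 0).hom.app M ≫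
      inv (DerivedCategory.Q.map P.π')) ≫ DerivedCategory.Q.map (extendHom R hd) := by
  have hn := R.mapDerivedCategoryFactors_hom_naturality Q.π'
  have : IsIso (DerivedCategory.Q.map
      ((R.mapHomologicalComplex (ComplexShape.up ℤ)).map Q.π')) := by
    rw [← IsIso.inv_comp_eq] at hn
    rw [← hn]
    infer_instance
  have hc := extendHom_comp_map_π' R hd j h0
  have hs := R.mapDerivedCategorySingleFunctor_inv_app_mapDerivedCategoryFactors_hom_app M'
  have hσ : extendHom R hd ≫ (R.mapHomologicalComplex (ComplexShape.up ℤ)).map Q.π' =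
      P.π' ≫ (CochainComplex.singleFunctor A 0).map j ≫
        (R.mapCochainComplexSingleFunctor 0).inv.app M' := by
    rw [← Category.assoc, ← hc, Category.assoc, Category.assoc]
    erw [Iso.hom_inv_id_app, Category.comp_id]
  rw [← cancel_mono (DerivedCategory.Q.map
      ((R.mapHomologicalComplex (ComplexShape.up ℤ)).map Q.π'))]
  simp only [Category.assoc, ← hn, ← Functor.map_comp_assoc, ← Functor.map_comp]
  rw [hσ]
  simp only [Functor.map_comp, Category.assoc, IsIso.inv_hom_id_assoc]
  rw [← R.mapDerivedCategory.map_comp_assoc (inv (DerivedCategory.Q.map Q.π')),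
    IsIso.inv_hom_id, CategoryTheory.Functor.map_id, Category.id_comp]
  -- This component of `singleFunctorIsoCompQ` is an identity by definition.
  have h1 : R.mapDerivedCategory.map ((DerivedCategory.singleFunctorIsoCompQ B 0).hom.app M') =
    𝟙 _ := R.mapDerivedCategory.map_id _
  have h2 := (DerivedCategory.singleFunctorIsoCompQ A 0).hom.naturality_assoc j
    (DerivedCategory.Q.map ((R.mapCochainComplexSingleFunctor 0).inv.app M'))
  refine Eq.trans ?_ h2
  refine congrArg (fun f => (DerivedCategory.singleFunctor A 0).map j ≫ f) ?_
  rw [h1]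
  refine (congrArg (fun f => (R.mapDerivedCategorySingleFunctor 0).inv.app M' ≫ f)
    (Category.id_comp _)).trans (hs.trans ?_)
  exact (Category.id_comp _).symm

theorem inv_factors_comp [HasDerivedCategory A] [HasDerivedCategory B] (Y : B) :
    R.mapDerivedCategoryFactors.inv.app _ ≫
      R.mapDerivedCategory.map ((DerivedCategory.singleFunctorIsoCompQ B 0).inv.app Y) ≫
      (R.mapDerivedCategorySingleFunctor 0).hom.app Y =
    DerivedCategory.Q.map ((R.mapCochainComplexSingleFunctor 0).hom.app Y) ≫
      (DerivedCategory.singleFunctorIsoCompQ A 0).inv.app (R.obj Y) := by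
  have h := R.mapDerivedCategoryFactors_inv_app_mapDerivedCategorySingleFunctor_hom_app Y
  have h1 : R.mapDerivedCategory.map ((DerivedCategory.singleFunctorIsoCompQ B 0).inv.app Y) = 𝟙 _ :=
    R.mapDerivedCategory.map_id _
  rw [h1]
  refine (congrArg (fun f => R.mapDerivedCategoryFactors.inv.app _ ≫ f)
    (Category.id_comp _)).trans (h.trans ?_)
  exact (Category.comp_id _).symm

attribute [local instance] HasDerivedCategory.standard in
/-- The morphism `y ↦ R(y) ∘ j` on a class given by a cocycle of a projective resolution. -/
theorem mk₀_comp_mapExactFunctor_extMk [HasExt.{u} A] [HasExt.{u} B]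
    (hd : ∀ n, d (n + 1) ≫ R.map (Q.complex.d (n + 1) n) = P.complex.d (n + 1) n ≫ d n)
    (j : M ⟶ R.obj M') (h0 : d 0 ≫ R.map (Q.π.f 0) = P.π.f 0 ≫ j)
    {Y : B} {n : ℕ} (g : Q.complex.X n ⟶ Y) (hg : Q.complex.d (n + 1) n ≫ g = 0)
    (hg' : P.complex.d (n + 1) n ≫ d n ≫ R.map g = 0) :
    (Ext.mk₀ j).comp ((Q.extMk g (n + 1) rfl hg).mapExactFunctor R) (zero_add n) =
      P.extMk (d n ≫ R.map g) (n + 1) rfl hg' := by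
  ext
  rw [Ext.comp_hom, Ext.mapExactFunctor_hom, extMk_hom_eq, extMk_hom_eq,
    ← extendHom_comp_cocycleHom R hd g hg hg', Ext.mk₀_hom]
  simp only [ShiftedHom.map_comp, ShiftedHom.map_mk₀, ← ShiftedHom.comp_map]
  simp only [ShiftedHom.mk₀_comp, ShiftedHom.comp_mk₀]
  -- `h1` treats the source end, `h2` the target end after the shift by `n`, and `h3` moves `R`
  -- through the cocycle.
  have h1 := inv_π'_comp_extendHom R hd j h0
  have h2 := congrArg (fun φ => φ⟦(n : ℤ)⟧') (inv_factors_comp R Y)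
  have h3 := ShiftedHom.map_naturality_2 (cocycleHom Q g hg) R.mapDerivedCategoryFactors
  rw [ShiftedHom.comp_mk₀, ShiftedHom.mk₀_comp] at h3
  rw [← h3]
  simp only [Functor.map_comp, Category.assoc] at h1 h2 ⊢
  rw [h2, reassoc_of% h1]

end ExactFunctor

/-! ### The map on `Ext` induced by a left adjoint of an exact functor -/

section Adjoint

variable {A B : Type*} [Category A] [Abelian A] [Category B] [Abelian B]
  {L : A ⥤ B} {R : B ⥤ A} {M : A} {M' : B}

theorem homEquiv_cocycle_iff (adj : L ⊣ R) [R.Additive] {P₀ P₁ : A}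
    (d : P₁ ⟶ P₀) {Y : B} (g : L.obj P₀ ⟶ Y) :
    d ≫ adj.homEquiv _ _ g = 0 ↔ L.map d ≫ g = 0 := by
  rw [← adj.homEquiv_naturality_left, ← (adj.homEquiv P₁ Y).injective.eq_iff (b := 0)]
  simp [Adjunction.homEquiv_unit]

variable [L.PreservesZeroMorphisms]

theorem augmentation_f_zero (m : L.obj M ⟶ M') (P : ProjectiveResolution M) :
    (augmentation L m P).f 0 = L.map (P.π.f 0) ≫ m := by
  have h1 : ((ChainComplex.single₀ B).map m).f 0 = m := ChainComplex.single₀_map_f_zero m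
  have h2 := HomologicalComplex.singleMapHomologicalComplex_hom_app_self L
    (ComplexShape.down ℕ) 0 M
  change L.map (P.π.f 0) ≫ ((HomologicalComplex.singleMapHomologicalComplex L
    (ComplexShape.down ℕ) 0).hom.app M).f 0 ≫ ((ChainComplex.single₀ B).map m).f 0 = _
  rw [h1, h2]
  refine congrArg (fun f => L.map (P.π.f 0) ≫ f) ?_
  change (L.map (𝟙 M) ≫ 𝟙 _) ≫ m = m
  simp

/-- The complex `L(P)` as a projective resolution of `M'`. -/
@[simps complex π]
def mapResolution (adj : L ⊣ R) [R.PreservesEpimorphisms] (m : L.obj M ⟶ M')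
    (P : ProjectiveResolution M) (hP : QuasiIso (augmentation L m P)) :
    ProjectiveResolution M' where
  complex := (L.mapHomologicalComplex (ComplexShape.down ℕ)).obj P.complex
  projective n := adj.map_projective _ (P.projective n)
  π := augmentation L m P
  quasiIso := hP

variable [R.Additive] [PreservesFiniteLimits R] [PreservesFiniteColimits R]
  [HasExt.{u} A] [HasExt.{u} B]

/-- The map `Ext^n(M', Y) ⟶ Ext^n(M, R(Y))`, `y ↦ R(y) ∘ j`. -/
def extRestrict (R : B ⥤ A) [R.Additive] [PreservesFiniteLimits R] [PreservesFiniteColimits R]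
    (j : M ⟶ R.obj M') (Y : B) (n : ℕ) : Ext.{u} M' Y n →+ Ext.{u} M (R.obj Y) n :=
  ((Ext.mk₀ j).precomp (R.obj Y) (zero_add n)).comp (R.mapExtAddHom M' Y n)

theorem extRestrict_apply (j : M ⟶ R.obj M') {Y : B} {n : ℕ} (y : Ext.{u} M' Y n) :
    extRestrict R j Y n y = (Ext.mk₀ j).comp (y.mapExactFunctor R) (zero_add n) := rfl

variable (adj : L ⊣ R) {j : M ⟶ R.obj M'}

/-- On cochains the map is the adjunction bijection. The chain map to which
`mk₀_comp_mapExactFunctor_extMk` applies is the unit `P → R(L(P))`, which covers `j` because the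
augmentation of `L(P)` is built from the adjoint of `j`. -/
theorem extRestrict_extMk (P : ProjectiveResolution M)
    (hP : QuasiIso (augmentation L ((adj.homEquiv M M').symm j) P))
    {Y : B} {n : ℕ} (g : L.obj (P.complex.X n) ⟶ Y)
    (hg : L.map (P.complex.d (n + 1) n) ≫ g = 0) :
    extRestrict R j Y n ((mapResolution adj _ P hP).extMk g (n + 1) rfl hg) =
      P.extMk (adj.homEquiv _ _ g) (n + 1) rfl ((homEquiv_cocycle_iff adj _ _).2 hg) := by
  have hd (n : ℕ) : adj.unit.app (P.complex.X (n + 1)) ≫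
      R.map (L.map (P.complex.d (n + 1) n)) =
        P.complex.d (n + 1) n ≫ adj.unit.app (P.complex.X n) :=
    (adj.unit.naturality (P.complex.d (n + 1) n)).symm
  have h0 : adj.unit.app (P.complex.X 0) ≫
      R.map ((augmentation L ((adj.homEquiv M M').symm j) P).f 0) = P.π.f 0 ≫ j := by
    have hp {X : A} (p : X ⟶ M) :
        adj.unit.app X ≫ R.map (L.map p ≫ (adj.homEquiv M M').symm j) = p ≫ j := by
      refine (adj.homEquiv_unit _ _ _).symm.trans ?_
      rw [adj.homEquiv_naturality_left, Equiv.apply_symm_apply]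
    exact (congrArg (fun f => adj.unit.app (P.complex.X 0) ≫ R.map f)
      (augmentation_f_zero _ P)).trans (hp _)
  refine (mk₀_comp_mapExactFunctor_extMk R (Q := mapResolution adj _ P hP)
    (d := fun n => adj.unit.app (P.complex.X n)) hd j h0 g hg ?_).trans ?_
  · exact (congrArg (fun f => P.complex.d (n + 1) n ≫ f) (adj.homEquiv_unit _ _ g).symm).trans
      ((homEquiv_cocycle_iff adj _ _).2 hg)
  · congr 1

/-- The adjunction matches cocycles with cocycles and coboundaries with coboundaries, so it is
bijective on cohomology. -/
theorem extRestrict_bijective (P : ProjectiveResolution M)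
    (hP : QuasiIso (augmentation L ((adj.homEquiv M M').symm j) P))
    (hm : IsIso ((adj.homEquiv M M').symm j)) (Y : B) (n : ℕ) :
    Function.Bijective (extRestrict R j Y n) := by
  constructor
  · rw [injective_iff_map_eq_zero]
    intro y hy
    cases n with
    -- There are no coboundaries in degree 0: the class is a morphism `g`, and cancelling the
    -- isomorphism adjoint to `j` gives `g = 0`.
    | zero =>
      obtain ⟨g, rfl⟩ := (Ext.mk₀_bijective M' Y).2 y
      rw [extRestrict_apply, Ext.mapExactFunctor_mk₀, Ext.mk₀_comp_mk₀, ← Ext.mk₀_zero,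
        (Ext.mk₀_bijective _ _).1.eq_iff] at hy
      have h : (adj.homEquiv M M').symm j ≫ g = 0 := by
        rw [← adj.homEquiv_naturality_right_symm, hy]
        simp [Adjunction.homEquiv_counit]
      rw [(cancel_epi ((adj.homEquiv M M').symm j)).1 (h.trans comp_zero.symm), Ext.mk₀_zero]
    | succ n =>
      obtain ⟨g, hg, rfl⟩ := (mapResolution adj _ P hP).extMk_surjective y (n + 2) rfl
      have h := extRestrict_extMk adj P hP g hg
      rw [hy, eq_comm, P.extMk_eq_zero_iff _ _ _ _ n rfl] at h
      obtain ⟨f, hf⟩ := h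
      refine ((mapResolution adj _ P hP).extMk_eq_zero_iff _ _ _ hg n rfl).2
        ⟨(adj.homEquiv _ _).symm f, (adj.homEquiv _ _).injective ?_⟩
      refine (adj.homEquiv_naturality_left _ _).trans ?_
      rw [Equiv.apply_symm_apply]
      exact hf
  · intro x
    obtain ⟨f, hf, rfl⟩ := P.extMk_surjective x (n + 1) rfl
    obtain ⟨g, rfl⟩ := (adj.homEquiv _ _).surjective f
    exact ⟨_, extRestrict_extMk adj P hP g ((homEquiv_cocycle_iff adj _ _).1 hf)⟩

/-- For a projective resolution `Q → M'` and a chain map `c : Q → L(P)` over `M'`, the classes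
of `c ≫ L(f) ≫ m` and of `f` correspond to each other. -/
theorem extRestrict_extMk_comp (P : ProjectiveResolution M)
    (hP : QuasiIso (augmentation L ((adj.homEquiv M M').symm j) P)) (Q : ProjectiveResolution M')
    (c : Q.complex ⟶ (L.mapHomologicalComplex (ComplexShape.down ℕ)).obj P.complex)
    (hc : c ≫ augmentation L ((adj.homEquiv M M').symm j) P = Q.π) {n : ℕ}
    (f : P.complex.X n ⟶ M) (hf : P.complex.d (n + 1) n ≫ f = 0) :
    extRestrict R j M' n (Q.extMk (c.f n ≫ L.map f ≫ (adj.homEquiv M M').symm j) (n + 1) rfl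
      (induced_cocycle L _ c hf)) =
      (P.extMk f (n + 1) rfl hf).comp (Ext.mk₀ j) (add_zero n) := by
  have hg : L.map (P.complex.d (n + 1) n) ≫ L.map f ≫ (adj.homEquiv M M').symm j = 0 := by
    rw [← L.map_comp_assoc, hf, L.map_zero, zero_comp]
  -- Read as a morphism of resolutions over `𝟙 M'`, `c` turns the representative on `L(P)` into one
  -- on `Q` of the same class.
  let φ : ProjectiveResolution.Hom Q (mapResolution adj _ P hP) (𝟙 M') :=
    { hom := c
      hom_f_zero_comp_π_f_zero := by
        rw [CategoryTheory.Functor.map_id, HomologicalComplex.id_f, Category.comp_id]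
        exact HomologicalComplex.congr_hom hc 0 }
  have h := ProjectiveResolution.mk₀_comp_extMk (R := mapResolution adj _ P hP)
    (L.map f ≫ (adj.homEquiv M M').symm j) (n + 1) rfl hg φ
  rw [Ext.mk₀_id_comp] at h
  rw [ProjectiveResolution.extMk_comp_mk₀]
  refine (congrArg (extRestrict R j M' n) h.symm).trans ((extRestrict_extMk adj P hP _ hg).trans ?_)
  congr 1
  rw [adj.homEquiv_naturality_left, Equiv.apply_symm_apply]

end Adjoint

/-! ### The algebra homomorphism defined by `R(y) ∘ j = j ∘ x` -/

section InducedAlgHom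

variable {A B : Type*} [Category A] [Abelian A] [Category B] [Abelian B]
  [HasExt.{u} A] [HasExt.{u} B] (k : Type u) [Field k] [Linear k A] [Linear k B]
  {R : B ⥤ A} [R.Additive] [PreservesFiniteLimits R] [PreservesFiniteColimits R] [R.Linear k]
  {M : A} {M' : B} {j : M ⟶ R.obj M'} (hj : ∀ n, Function.Bijective (extRestrict.{u} R j M' n))

/-- The linear version of `extRestrict`. -/
def extRestrictₗ (R : B ⥤ A) [R.Additive] [PreservesFiniteLimits R] [PreservesFiniteColimits R]
    [R.Linear k] (j : M ⟶ R.obj M') (Y : B) (n : ℕ) :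
    Ext.{u} M' Y n →ₗ[k] Ext.{u} M (R.obj Y) n where
  __ := extRestrict R j Y n
  map_smul' r y := by
    change (Ext.mk₀ j).comp ((r • y).mapExactFunctor R) (zero_add n) =
      r • (Ext.mk₀ j).comp (y.mapExactFunctor R) (zero_add n)
    rw [Functor.mapExactFunctor_smul, Ext.comp_smul]

/-- The map `Ext^n(M, M) ⟶ Ext^n(M', M')`, `x ↦ y` where `R(y) ∘ j = j ∘ x`. -/
def extInduced (n : ℕ) : Ext.{u} M M n →ₗ[k] Ext.{u} M' M' n :=
  (LinearEquiv.ofBijective (extRestrictₗ k R j M' n) (hj n)).symm.toLinearMap ∘ₗ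
    { toFun x := x.comp (Ext.mk₀ j) (add_zero n)
      map_add' _ _ := Ext.add_comp _ _ _ _
      map_smul' _ _ := Ext.smul_comp _ _ _ _ }

theorem extRestrict_extInduced {n : ℕ} (x : Ext.{u} M M n) :
    extRestrict R j M' n (extInduced k hj n x) = x.comp (Ext.mk₀ j) (add_zero n) :=
  (LinearEquiv.ofBijective (extRestrictₗ k R j M' n) (hj n)).apply_symm_apply _

/-- Injectivity of `extRestrict` makes this equation a characterisation; the algebraic properties
below are checks of it. -/
theorem extInduced_eq_iff {n : ℕ} (x : Ext.{u} M M n) (y : Ext.{u} M' M' n) :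
    extInduced k hj n x = y ↔ x.comp (Ext.mk₀ j) (add_zero n) = extRestrict R j M' n y := by
  rw [← (hj n).1.eq_iff, extRestrict_extInduced]

/-- As `R` respects Yoneda products, `j` slides past one factor at a time: in diagrammatic order,
with `x'`, `y'` the images, `j R(x') R(y') = x j R(y') = x y j`. -/
theorem extInduced_comp {a b c : ℕ} (x : Ext.{u} M M a) (y : Ext.{u} M M b) (h : a + b = c) :
    extInduced k hj c (x.comp y h) = (extInduced k hj a x).comp (extInduced k hj b y) h := by
  rw [extInduced_eq_iff, extRestrict_apply, Ext.mapExactFunctor_comp,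
    ← Ext.comp_assoc _ _ _ (zero_add a) h (by omega), ← extRestrict_apply,
    extRestrict_extInduced, Ext.comp_assoc _ _ _ (add_zero a) (zero_add b) (by omega),
    ← extRestrict_apply, extRestrict_extInduced, Ext.comp_assoc _ _ _ h (add_zero b) (by omega)]

theorem extInduced_id : extInduced k hj 0 (Ext.mk₀ (𝟙 M)) = Ext.mk₀ (𝟙 M') := by
  rw [extInduced_eq_iff, extRestrict_apply, Ext.mapExactFunctor_mk₀,
    CategoryTheory.Functor.map_id, Ext.mk₀_id_comp, Ext.comp_mk₀_id]

/-- The algebra homomorphism `Ext^*(M, M) ⟶ Ext^*(M', M')` with components `extInduced`. -/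
def inducedAlgHom : ExtAlg.{u} M →ₐ[k] ExtAlg.{u} M' :=
  DirectSum.toAlgebra k (fun n : ℕ => Ext.{u} M M n)
    (fun n => DirectSum.lof k ℕ (fun n : ℕ => Ext.{u} M' M' n) n ∘ₗ extInduced k hj n)
    (congrArg (homog 0) (extInduced_id k hj))
    (fun {a b} x y => by
      -- The arguments are swapped because the product `x * y` is `y.comp x`.
      refine Eq.trans (congrArg (homog (a + b)) (extInduced_comp k hj y x (add_comm b a))) ?_
      exact (DirectSum.of_mul_of (A := fun n : ℕ => Ext.{u} M' M' n)
        (extInduced k hj a x) (extInduced k hj b y)).symm)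

theorem inducedAlgHom_homog {n : ℕ} (x : Ext.{u} M M n) :
    inducedAlgHom k hj (homog n x) = homog n (extInduced k hj n x) :=
  DirectSum.toAddMonoid_of (fun n => (DirectSum.lof k ℕ (fun n : ℕ => Ext.{u} M' M' n) n ∘ₗ
    extInduced k hj n).toAddMonoidHom) n x

theorem isGraded_inducedAlgHom : IsGraded (inducedAlgHom k hj) :=
  fun _ x => ⟨_, inducedAlgHom_homog k hj x⟩

/-- The homomorphism is built from `R` and `j` alone, so it serves every left adjoint `L` of `R` for
which the augmented complexes are exact; `extRestrict_extMk_comp` is the check on cocycles. -/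
theorem isInducedBy_inducedAlgHom {L : A ⥤ B} [L.PreservesZeroMorphisms] (adj : L ⊣ R)
    (m : L.obj M ⟶ M') (hm : adj.homEquiv M M' m = j) [IsIso m]
    (hP : ∀ P : ProjectiveResolution M, QuasiIso (augmentation L m P)) :
    IsInducedBy L m (inducedAlgHom k hj) where
  isIso := inferInstance
  quasiIso := hP
  map_add := map_add _
  map_class P Q c hc n f hf := by
    obtain rfl : m = (adj.homEquiv M M').symm j := ((Equiv.symm_apply_eq _).2 hm.symm).symm
    rw [inducedAlgHom_homog]
    congr 1
    rw [extInduced_eq_iff]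
    exact (extRestrict_extMk_comp adj P (hP P) Q c hc f hf).symm

theorem inducedAlgHom_apply (x : ExtAlg.{u} M) (n : ℕ) :
    inducedAlgHom k hj x n = extInduced k hj n (x n) := by
  induction x using DirectSum.induction_on with
  | zero => simp
  | of i x =>
    rw [inducedAlgHom_homog]
    by_cases h : i = n
    · subst h; simp [homog]
    · simp [homog, DirectSum.of_eq_of_ne _ _ _ (Ne.symm h)]
  | add x y hx hy => simp [hx, hy]

/-- For invertible `j` the inverse is `y ↦ j⁻¹ ∘ R(y) ∘ j`. -/
theorem bijective_inducedAlgHom [IsIso j] : Function.Bijective (inducedAlgHom k hj) := by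
  constructor
  · rw [injective_iff_map_eq_zero]
    intro x hx
    ext n
    have h := inducedAlgHom_apply k hj x n
    rw [hx, DirectSum.zero_apply, eq_comm, extInduced_eq_iff, map_zero] at h
    rw [DirectSum.zero_apply, ← Ext.comp_mk₀_id (x n), ← IsIso.hom_inv_id j, ← Ext.mk₀_comp_mk₀,
      ← Ext.comp_assoc _ _ _ (add_zero n) (zero_add 0) (by omega), h, Ext.zero_comp]
  · intro y
    induction y using DirectSum.induction_on with
    | zero => exact ⟨0, map_zero _⟩
    | of n y =>
      refine ⟨homog n ((extRestrict R j M' n y).comp (Ext.mk₀ (inv j)) (add_zero n)), ?_⟩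
      rw [inducedAlgHom_homog]
      congr 1
      rw [extInduced_eq_iff, Ext.comp_assoc _ _ _ (add_zero n) (zero_add 0) (by omega),
        Ext.mk₀_comp_mk₀, IsIso.inv_hom_id, Ext.comp_mk₀_id]
    | add x y hx hy =>
      obtain ⟨x, rfl⟩ := hx
      obtain ⟨y, rfl⟩ := hy
      exact ⟨x + y, map_add _ _ _⟩

end InducedAlgHom

/-! ### Functors preserving the exactness of projective resolutions -/

section Acyclic

variable {A B D : Type*} [Category A] [Abelian A] [Category B] [Abelian B] [Category D] [Abelian D]

/-- `L` preserves the exactness of the projective resolutions of `M`. -/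
def IsAcyclicAt (L : A ⥤ B) [L.PreservesZeroMorphisms] (M : A) : Prop :=
  ∀ P : ProjectiveResolution M,
    QuasiIso ((L.mapHomologicalComplex (ComplexShape.down ℕ)).map P.π)

variable {L L' : A ⥤ B} [L.PreservesZeroMorphisms] [L'.PreservesZeroMorphisms] {M : A} {M' : B}

theorem IsAcyclicAt.quasiIso_augmentation (h : IsAcyclicAt L M) (m : L.obj M ⟶ M') [IsIso m]
    (P : ProjectiveResolution M) : QuasiIso (augmentation L m P) := by
  have := h P
  unfold augmentation
  infer_instance

theorem IsAcyclicAt.of_iso (h : IsAcyclicAt L M) (e : L ≅ L') : IsAcyclicAt L' M := fun P => by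
  have := h P
  refine quasiIso_of_arrow_mk_iso _ _ (Arrow.isoMk
    ((NatIso.mapHomologicalComplex e (ComplexShape.down ℕ)).app P.complex)
    ((NatIso.mapHomologicalComplex e (ComplexShape.down ℕ)).app _)
    ((NatIso.mapHomologicalComplex e (ComplexShape.down ℕ)).hom.naturality P.π).symm) (hφ := this)

theorem IsAcyclicAt.of_exact [L.Additive] [L.PreservesHomology] :
    IsAcyclicAt L M := fun P => by
  infer_instance

/-- `L(P)` is a projective resolution of `M'`, so `G` keeps it exact; the identification `L(M) ≅ M'`
is an isomorphism and can be cancelled. -/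
theorem IsAcyclicAt.comp {R : B ⥤ A} (adj : L ⊣ R) [R.PreservesEpimorphisms]
    (h : IsAcyclicAt L M) (m : L.obj M ⟶ M') [IsIso m] {G : B ⥤ D} [G.PreservesZeroMorphisms]
    (hG : IsAcyclicAt G M') : IsAcyclicAt (L ⋙ G) M := fun P => by
  have h1 := hG (mapResolution adj m P (h.quasiIso_augmentation m P))
  have h2 : (G.mapHomologicalComplex (ComplexShape.down ℕ)).map (augmentation L m P) =
    (G.mapHomologicalComplex (ComplexShape.down ℕ)).map
      ((L.mapHomologicalComplex (ComplexShape.down ℕ)).map P.π) ≫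
    (G.mapHomologicalComplex (ComplexShape.down ℕ)).map
      ((HomologicalComplex.singleMapHomologicalComplex L (ComplexShape.down ℕ) 0).hom.app M ≫
      (ChainComplex.single₀ B).map m) := Functor.map_comp _ _ _
  have h3 : QuasiIso ((G.mapHomologicalComplex (ComplexShape.down ℕ)).map
    (augmentation L m P)) := h1
  rw [h2, quasiIso_iff_comp_right] at h3
  exact h3

/-- A projective resolution of a projective object is homotopy equivalent to that object, and every
additive functor preserves homotopy equivalences. No exactness of `G` is needed. -/
theorem IsAcyclicAt.comp_of_projective {R : B ⥤ A} (adj : L ⊣ R) [R.PreservesEpimorphisms]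
    (h : IsAcyclicAt L M) [Projective (L.obj M)] {G : B ⥤ D} [G.Additive] :
    IsAcyclicAt (L ⋙ G) M := by
  refine h.comp adj (𝟙 _) fun Q => ?_
  have h : ((Q.homotopyEquiv (ProjectiveResolution.self (L.obj M))).hom : _) = Q.π :=
    (Category.comp_id _).symm.trans
      (Q.homotopyEquiv_hom_π (ProjectiveResolution.self (L.obj M)))
  have : QuasiIso (G.mapHomotopyEquiv
    (Q.homotopyEquiv (ProjectiveResolution.self (L.obj M)))).hom := inferInstance
  rw [Functor.mapHomotopyEquiv_hom, h] at this
  exact this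

/-- Evaluation functors are exact, so homology in a functor category is computed pointwise. -/
theorem quasiIsoAt_of_evaluation {C : Type*} [Category C] {K K' : ChainComplex (C ⥤ B) ℕ}
    (φ : K ⟶ K') (n : ℕ)
    (h : ∀ x, QuasiIsoAt ((((evaluation C B).obj x).mapHomologicalComplex
      (ComplexShape.down ℕ)).map φ) n) : QuasiIsoAt φ n := by
  rw [quasiIsoAt_iff, ShortComplex.quasiIso_iff, NatTrans.isIso_iff_isIso_app]
  intro x
  have hx := h x
  rw [quasiIsoAt_iff, ShortComplex.quasiIso_iff] at hx
  have h1 := ShortComplex.mapHomologyIso_hom_naturality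
    ((HomologicalComplex.shortComplexFunctor _ _ n).map φ) ((evaluation C B).obj x)
  rw [← Iso.inv_comp_eq] at h1
  have : IsIso (ShortComplex.homologyMap (((evaluation C B).obj x).mapShortComplex.map
    ((HomologicalComplex.shortComplexFunctor _ _ n).map φ))) := hx
  have h2 : IsIso (((evaluation C B).obj x).map (ShortComplex.homologyMap
      ((HomologicalComplex.shortComplexFunctor _ _ n).map φ))) := by
    rw [← h1]
    exact IsIso.comp_isIso' inferInstance (IsIso.comp_isIso' this inferInstance)
  exact h2

theorem IsAcyclicAt.of_evaluation {C : Type*} [Category C] {T : A ⥤ C ⥤ B}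
    [T.PreservesZeroMorphisms] (h : ∀ x, IsAcyclicAt (T ⋙ (evaluation C B).obj x) M) :
    IsAcyclicAt T M := fun P =>
  ⟨fun n => quasiIsoAt_of_evaluation _ n fun x => (h x P).quasiIsoAt n⟩

end Acyclic

/-! ### Linearity of restriction, and auxiliary facts on composites and linear combinations -/

section Restriction

variable (k : Type u) [Field k] {C : Type u} [SmallCategory C]

instance {D : Type u} [SmallCategory D] (θ : C ⥤ D) :
    ((Functor.whiskeringLeft C D (ModuleCat.{u} k)).obj θ).Linear k where
  map_smul _ _ := rfl

variable {k}

theorem comp_comp_eq_of_comp_eq {A : Type*} [Category A] {X Y Y' Z W : A} {f : X ⟶ Y} {g : Y ⟶ Z}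
    {f' : X ⟶ Y'} {g' : Y' ⟶ Z} (h : f ≫ g = f' ≫ g') (t : Z ⟶ W) :
    f ≫ g ≫ t = f' ≫ g' ≫ t := by
  rw [← Category.assoc, h, Category.assoc]

theorem comp_comp_eq_comp {A : Type*} [Category A] {X Y Z W : A} {f : X ⟶ Y} {g : Y ⟶ Z}
    {f' : X ⟶ Z} (h : f ≫ g = f') (t : Z ⟶ W) : f ≫ g ≫ t = f' ≫ t := by
  rw [← Category.assoc, h]

/-- `Finsupp.linearCombination` with values in an object of `ModuleCat k`. -/
def linearCombinationTo {ι : Type u} (X : ModuleCat.{u} k) (v : ι → X) : (ι →₀ k) →ₗ[k] X :=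
  Finsupp.linearCombination k v

theorem linearCombinationTo_single {ι : Type u} (X : ModuleCat.{u} k) (v : ι → X) (i : ι) :
    linearCombinationTo X v (Finsupp.single i 1) = v i := by
  rw [linearCombinationTo, Finsupp.linearCombination_single, one_smul]

/-! ### The left adjoint of restriction along `τ` -/

namespace FactCat

/-- The object `[α]` of the category of factorizations. -/
abbrev of {x y : C} (α : y ⟶ x) : FactCat C := ⟨y, x, α⟩

/-- The morphism `[α] ⟶ [u ∘ α ∘ v]`. -/
abbrev homOf {x y x' y' : C} (α : y ⟶ x) (g : x ⟶ x') (h : y' ⟶ y) :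
    of α ⟶ of (h ≫ α ≫ g) := ⟨g, h, rfl⟩

variable (M M' : FactCat C ⥤ ModuleCat.{u} k)

/-- The value at `(x, y)` of the left Kan extension of `M` along `τ`: the direct sum of the
`M([α])` over `α : y ⟶ x`. -/
def sumObj (p : C × Cᵒᵖ) : ModuleCat.{u} k := ∐ fun α : p.2.unop ⟶ p.1 => M.obj (of α)

/-- The inclusion of the summand `M(a)`. -/
def sumι (a : FactCat C) : M.obj a ⟶ sumObj M (a.tgt, op a.src) :=
  Sigma.ι (fun α : a.src ⟶ a.tgt => M.obj (of α)) a.arr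

variable {M M'}

/-- A morphism out of the direct sum. -/
def sumDesc {p : C × Cᵒᵖ} {X : ModuleCat.{u} k} (f : ∀ α : p.2.unop ⟶ p.1, M.obj (of α) ⟶ X) :
    sumObj M p ⟶ X := Sigma.desc f

theorem sumι_sumDesc {x y : C} {X : ModuleCat.{u} k} (f : ∀ α : y ⟶ x, M.obj (of α) ⟶ X)
    (α : y ⟶ x) : sumι M (of α) ≫ sumDesc (p := (x, op y)) f = f α :=
  Sigma.ι_desc _ _

theorem sumι_sumDesc_assoc {x y : C} {X : ModuleCat.{u} k} (f : ∀ α : y ⟶ x, M.obj (of α) ⟶ X)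
    (α : y ⟶ x) {Z : ModuleCat.{u} k} (h : X ⟶ Z) :
    sumι M (of α) ≫ sumDesc (p := (x, op y)) f ≫ h = f α ≫ h :=
  comp_comp_eq_comp (sumι_sumDesc f α) h

theorem sumObj_hom_ext {x y : C} {X : ModuleCat.{u} k} {f g : sumObj M (x, op y) ⟶ X}
    (h : ∀ α : y ⟶ x, sumι M (of α) ≫ f = sumι M (of α) ≫ g) : f = g :=
  Sigma.hom_ext _ _ h

/-- The pair `(u, v)` determines the codomain `[β]`, but equal composites may be written
differently. This lemma identifies the corresponding summands. -/
theorem map_sumι {a : FactCat C} {x y : C} {β β' : y ⟶ x} (f : a ⟶ of β) (f' : a ⟶ of β')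
    (hu : f.u = f'.u) (hv : f.v = f'.v) : M.map f ≫ sumι M (of β) = M.map f' ≫ sumι M (of β') := by
  obtain rfl : β = β' := by
    have h := f.w
    have h' := f'.w
    rw [hu, hv] at h
    exact h.symm.trans h'
  obtain rfl : f = f' := Hom.ext hu hv
  rfl

variable (M) in
/-- The map induced by a morphism of `C × Cᵒᵖ`. -/
def sumMap {p q : C × Cᵒᵖ} (g : p ⟶ q) : sumObj M p ⟶ sumObj M q :=
  sumDesc fun α => M.map (homOf α g.1 g.2.unop) ≫ sumι M (of (g.2.unop ≫ α ≫ g.1))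

theorem sumι_sumMap {a b : FactCat C} (f : a ⟶ b) :
    sumι M a ≫ sumMap M ((τ C).map f) = M.map f ≫ sumι M b := by
  refine (sumι_sumDesc _ a.arr).trans ?_
  exact map_sumι (a := a) (x := b.tgt) (y := b.src) (homOf a.arr f.u f.v) f rfl rfl

theorem sumι_sumMap_assoc {a b : FactCat C} (f : a ⟶ b) {Z : ModuleCat.{u} k}
    (h : sumObj M (b.tgt, op b.src) ⟶ Z) :
    sumι M a ≫ sumMap M ((τ C).map f) ≫ h = M.map f ≫ sumι M b ≫ h :=
  comp_comp_eq_of_comp_eq (sumι_sumMap f) h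

variable (M) in
/-- The left Kan extension of `M` along `τ`. -/
def sumFunctor : C × Cᵒᵖ ⥤ ModuleCat.{u} k where
  obj := sumObj M
  map := sumMap M
  map_id p := by
    obtain ⟨x, ⟨y⟩⟩ := p
    refine sumObj_hom_ext fun α => ?_
    refine (sumι_sumMap (𝟙 (of α))).trans ?_
    rw [CategoryTheory.Functor.map_id, Category.id_comp]
    exact (Category.comp_id _).symm
  map_comp {p q r} g h := by
    obtain ⟨x, ⟨y⟩⟩ := p
    obtain ⟨x', ⟨y'⟩⟩ := q
    obtain ⟨x'', ⟨y''⟩⟩ := r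
    refine sumObj_hom_ext fun α => ?_
    let f₁ : of α ⟶ of (g.2.unop ≫ α ≫ g.1) := homOf α g.1 g.2.unop
    let f₂ : of (g.2.unop ≫ α ≫ g.1) ⟶ of (h.2.unop ≫ (g.2.unop ≫ α ≫ g.1) ≫ h.1) :=
      homOf _ h.1 h.2.unop
    refine (sumι_sumMap (f₁ ≫ f₂)).trans ?_
    refine Eq.trans ?_ (sumι_sumMap_assoc f₁ (sumMap M h)).symm
    refine Eq.trans ?_ (M.map f₁ ≫= (sumι_sumMap f₂).symm)
    exact ((M.map_comp f₁ f₂) =≫ _).trans (Category.assoc _ _ _)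

/-- The components of `sumFunctorMap`. -/
def sumObjMap (φ : M ⟶ M') (p : C × Cᵒᵖ) : sumObj M p ⟶ sumObj M' p :=
  Limits.Sigma.map fun α : p.2.unop ⟶ p.1 => φ.app (of α)

theorem sumι_sumObjMap (φ : M ⟶ M') {x y : C} (α : y ⟶ x) :
    sumι M (of α) ≫ sumObjMap φ (x, op y) = φ.app (of α) ≫ sumι M' (of α) :=
  Sigma.ι_map (fun α : y ⟶ x => φ.app (of α)) α

theorem sumι_sumObjMap_assoc (φ : M ⟶ M') {x y : C} (α : y ⟶ x) {Z : ModuleCat.{u} k}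
    (h : sumObj M' (x, op y) ⟶ Z) :
    sumι M (of α) ≫ sumObjMap φ (x, op y) ≫ h = φ.app (of α) ≫ sumι M' (of α) ≫ h :=
  comp_comp_eq_of_comp_eq (sumι_sumObjMap φ α) h

/-- The map of left Kan extensions along `τ` induced by a natural transformation. -/
def sumFunctorMap (φ : M ⟶ M') : sumFunctor M ⟶ sumFunctor M' where
  app := sumObjMap φ
  naturality p q g := by
    obtain ⟨x, ⟨y⟩⟩ := p
    obtain ⟨x', ⟨y'⟩⟩ := q
    refine sumObj_hom_ext fun α => ?_
    let f : of α ⟶ of (g.2.unop ≫ α ≫ g.1) := homOf α g.1 g.2.unop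
    refine (sumι_sumMap_assoc f _).trans (Eq.trans ?_ (sumι_sumObjMap_assoc φ α _).symm)
    refine (M.map f ≫= sumι_sumObjMap φ _).trans (Eq.trans ?_ (φ.app _ ≫= (sumι_sumMap f).symm))
    rw [NatTrans.naturality_assoc]

variable (k C) in
/-- The left Kan extension along `τ` as a functor. -/
def sumTau : (FactCat C ⥤ ModuleCat.{u} k) ⥤ (C × Cᵒᵖ ⥤ ModuleCat.{u} k) where
  obj := sumFunctor
  map := sumFunctorMap
  map_id M := by
    ext ⟨x, ⟨y⟩⟩ : 2
    refine sumObj_hom_ext fun α => ?_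
    exact (sumι_sumObjMap (𝟙 M) α).trans ((Category.id_comp _).trans (Category.comp_id _).symm)
  map_comp φ ψ := by
    ext ⟨x, ⟨y⟩⟩ : 2
    refine sumObj_hom_ext fun α => ?_
    refine (sumι_sumObjMap (φ ≫ ψ) α).trans (Eq.trans ?_ (sumι_sumObjMap_assoc φ α _).symm)
    refine Eq.trans ?_ (φ.app _ ≫= (sumι_sumObjMap ψ α).symm)
    rw [NatTrans.comp_app, Category.assoc]

/-- Morphisms out of `sumFunctor M`. -/
def sumTauHomEquiv (M : FactCat C ⥤ ModuleCat.{u} k) (N : C × Cᵒᵖ ⥤ ModuleCat.{u} k) :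
    (sumFunctor M ⟶ N) ≃ (M ⟶ τ C ⋙ N) where
  toFun f :=
    { app a := sumι M a ≫ f.app (a.tgt, op a.src)
      naturality a b g := by
        refine (sumι_sumMap_assoc g _).symm.trans ?_
        refine Eq.trans ?_ (Category.assoc _ _ _).symm
        exact sumι M a ≫= f.naturality ((τ C).map g) }
  invFun g :=
    { app p := sumDesc (X := N.obj p) fun α : p.2.unop ⟶ p.1 => g.app (of α)
      naturality p q f := by
        obtain ⟨x, ⟨y⟩⟩ := p
        obtain ⟨x', ⟨y'⟩⟩ := q
        refine sumObj_hom_ext fun α => ?_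
        let f' : of α ⟶ of (f.2.unop ≫ α ≫ f.1) := homOf α f.1 f.2.unop
        refine (sumι_sumMap_assoc f' _).trans ?_
        refine (M.map f' ≫= sumι_sumDesc (X := N.obj (x', op y')) (fun α => g.app (of α)) _).trans ?_
        exact (g.naturality f').trans
          (sumι_sumDesc_assoc (X := N.obj (x, op y)) (fun α => g.app (of α)) α (N.map f)).symm }
  left_inv f := by
    ext ⟨x, ⟨y⟩⟩ : 2
    exact sumObj_hom_ext fun α => sumι_sumDesc _ α
  right_inv g := by
    ext a : 2
    exact sumι_sumDesc (X := N.obj (a.tgt, op a.src)) (fun α => g.app (of α)) a.arr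

variable (k C) in
/-- `sumTau` is left adjoint to the restriction along `τ`. -/
def sumTauAdjunction : sumTau k C ⊣ (Functor.whiskeringLeft _ _ (ModuleCat.{u} k)).obj (τ C) :=
  Adjunction.mkOfHomEquiv
    { homEquiv := sumTauHomEquiv
      homEquiv_naturality_left_symm {M M' N} f g := by
        ext ⟨x, ⟨y⟩⟩ : 2
        refine sumObj_hom_ext fun α => ?_
        let g' : M' ⟶ τ C ⋙ N := g
        refine (sumι_sumDesc (X := N.obj (x, op y)) (fun α => f.app (of α) ≫ g'.app (of α)) α).trans
          (Eq.trans ?_ (sumι_sumObjMap_assoc f α _).symm)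
        exact f.app _ ≫= (sumι_sumDesc (X := N.obj (x, op y)) (fun α => g'.app (of α)) α).symm
      homEquiv_naturality_right {M N N'} f g := by
        ext a : 2
        exact (Category.assoc _ _ _).symm }

/-- Coproducts of vector spaces are exact. -/
instance (φ : M ⟶ M') [Mono φ] (p : C × Cᵒᵖ) : Mono (sumObjMap φ p) := by
  have (α : p.2.unop ⟶ p.1) : Mono (φ.app (of α)) := inferInstance
  have : Mono (Discrete.natTrans (F := Discrete.functor fun α : p.2.unop ⟶ p.1 => M.obj (of α))
      (G := Discrete.functor fun α : p.2.unop ⟶ p.1 => M'.obj (of α))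
      fun ⟨α⟩ => φ.app (of α)) := (NatTrans.mono_iff_mono_app _).2 fun ⟨α⟩ => this α
  exact colim.map_mono _

instance : (sumTau k C).PreservesMonomorphisms where
  preserves φ _ := (NatTrans.mono_iff_mono_app _).2 fun p =>
    inferInstanceAs (Mono (sumObjMap φ p))

instance : (sumTau k C).IsLeftAdjoint := (sumTauAdjunction k C).isLeftAdjoint

instance : (sumTau k C).Additive := (sumTauAdjunction k C).left_adjoint_additive

/-- A left adjoint preserves cokernels, so preserving monomorphisms makes it exact. The direct sum
formula is available because the fibre of `τ` over `(x, y)` is the discrete set `Hom(y, x)`. -/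
instance : (sumTau k C).PreservesHomology :=
  (sumTau k C).preservesHomology_of_preservesMonos_and_cokernels

variable (k C) in
/-- `LK_τ(k) ⟶ kC`. -/
def sumTauDesc : (sumTau k C).obj (triv k (FactCat C)) ⟶ bimod k C :=
  (sumTauHomEquiv _ _).symm (unitTau k C)

theorem sumι_sumTauDesc_app {x y : C} (α : y ⟶ x) :
    sumι (triv k (FactCat C)) (of α) ≫ (sumTauDesc k C).app (x, op y) =
      ModuleCat.ofHom (LinearMap.toSpanSingleton k ((y ⟶ x) →₀ k) (Finsupp.single α 1)) :=
  sumι_sumDesc (X := (bimod k C).obj (x, op y)) (fun α => (unitTau k C).app (of α)) α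

variable (k) in
/-- The inverse of `sumTauDesc`. -/
def sumTauDescInv (x y : C) :
    ModuleCat.of k ((y ⟶ x) →₀ k) ⟶ sumObj (triv k (FactCat C)) (x, op y) :=
  ModuleCat.ofHom (linearCombinationTo (sumObj (triv k (FactCat C)) (x, op y))
    fun α : y ⟶ x => (sumι (triv k (FactCat C)) (of α)).hom (1 : k))

theorem toSpanSingleton_sumTauDescInv {x y : C} (α : y ⟶ x) :
    ModuleCat.ofHom (LinearMap.toSpanSingleton k ((y ⟶ x) →₀ k) (Finsupp.single α 1)) ≫
      sumTauDescInv k x y = sumι (triv k (FactCat C)) (of α) := by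
  refine ModuleCat.hom_ext (LinearMap.ext_ring ?_)
  exact (congrArg (sumTauDescInv k x y).hom (one_smul k (Finsupp.single α (1 : k)))).trans
    (linearCombinationTo_single _ _ α)

/-- At `(x, y)` both sides are free on `Hom(y, x)`: the copy of `k` indexed by `α` goes to the line
spanned by `α`. -/
theorem isIso_sumTauDesc : IsIso (sumTauDesc k C) := by
  rw [NatTrans.isIso_iff_isIso_app]
  rintro ⟨x, ⟨y⟩⟩
  refine ⟨sumTauDescInv k x y, sumObj_hom_ext fun α => ?_, ?_⟩
  · refine (Category.assoc _ _ _).symm.trans ((sumι_sumTauDesc_app α =≫ sumTauDescInv k x y).trans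
      ((toSpanSingleton_sumTauDescInv α).trans (Category.comp_id _).symm))
  · refine ModuleCat.hom_ext (Finsupp.lhom_ext' fun α => LinearMap.ext_ring ?_)
    have h := congrArg (fun f => f.hom (1 : k)) (sumι_sumTauDesc_app (k := k) α)
    have h1 : (sumTauDescInv k x y).hom (Finsupp.single α 1) =
        (sumι (triv k (FactCat C)) (of α)).hom (1 : k) :=
      linearCombinationTo_single _ _ α
    refine (congrArg ((sumTauDesc k C).app (x, op y)).hom h1).trans (h.trans ?_)
    exact one_smul k (Finsupp.single α (1 : k))

end FactCat

end Restriction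

section TensorTrivial

variable {k : Type u} [Field k] {C : Type u} [SmallCategory C]

/-! ### The tensor product with the trivial module -/

section Tensor

variable (M M' : C × Cᵒᵖ ⥤ ModuleCat.{u} k)

/-- The canonical map `M(x, y) ⟶ (M ⊗_{kC} k)(x)`. -/
def tensorι (x y : C) : M.obj (x, op y) ⟶ (tensorObj (triv k C) M).obj x :=
  (ρ_ (M.obj (x, op y))).inv ≫
    coend.ι ((tensorBif (triv k C)).obj ((Functor.curry.obj M).obj x)) y

/-- Morphisms act trivially on `k`, so the coend relation only identifies an element with its images
under the right action: `(M ⊗_{kC} k)(x)` is the colimit of `M(x, -)`. -/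
theorem tensorι_condition (x : C) {y y' : C} (g : y ⟶ y') :
    M.map (X := (x, op y')) (Y := (x, op y)) (𝟙 x, g.op) ≫ tensorι M x y = tensorι M x y' := by
  have h := coend.condition ((tensorBif (triv k C)).obj ((Functor.curry.obj M).obj x)) g
  have h1 : (((tensorBif (triv k C)).obj ((Functor.curry.obj M).obj x)).obj (op y')).map g =
      𝟙 _ := MonoidalCategory.whiskerLeft_id _ _
  have h2 := MonoidalCategory.rightUnitor_inv_naturality
    (M.map (X := (x, op y')) (Y := (x, op y)) (𝟙 x, g.op))
  refine (Category.assoc _ _ _).symm.trans ((h2 =≫ _).trans ((Category.assoc _ _ _).trans ?_))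
  refine (ρ_ (M.obj (x, op y'))).inv ≫= (h.trans ?_)
  exact (h1 =≫ _).trans (Category.id_comp _)

theorem tensorι_condition_assoc (x : C) {y y' : C} (g : y ⟶ y') {Z : ModuleCat.{u} k}
    (h : (tensorObj (triv k C) M).obj x ⟶ Z) :
    M.map (X := (x, op y')) (Y := (x, op y)) (𝟙 x, g.op) ≫ tensorι M x y ≫ h =
      tensorι M x y' ≫ h :=
  comp_comp_eq_comp (tensorι_condition M x g) h

theorem tensorι_map {x x' : C} (g : x ⟶ x') (y : C) :
    tensorι M x y ≫ (tensorObj (triv k C) M).map g =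
      M.map (X := (x, op y)) (Y := (x', op y)) (g, 𝟙 _) ≫ tensorι M x' y := by
  have h2 := MonoidalCategory.rightUnitor_inv_naturality
    (M.map (X := (x, op y)) (Y := (x', op y)) (g, 𝟙 _))
  refine (Category.assoc _ _ _).trans (Eq.trans ?_ (Category.assoc _ _ _))
  refine Eq.trans ?_ (h2.symm =≫ _)
  exact ((ρ_ (M.obj (x, op y))).inv ≫= coend.ι_map
    ((tensorBif (triv k C)).map ((Functor.curry.obj M).map g)) y).trans (Category.assoc _ _ _).symm

theorem tensorι_map_assoc {x x' : C} (g : x ⟶ x') (y : C) {Z : ModuleCat.{u} k}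
    (h : (tensorObj (triv k C) M).obj x' ⟶ Z) :
    tensorι M x y ≫ (tensorObj (triv k C) M).map g ≫ h =
      M.map (X := (x, op y)) (Y := (x', op y)) (g, 𝟙 _) ≫ tensorι M x' y ≫ h :=
  comp_comp_eq_of_comp_eq (tensorι_map M g y) h

variable {M M'}

theorem tensorι_tensorMap_app (φ : M ⟶ M') (x y : C) :
    tensorι M x y ≫ (tensorMap (triv k C) φ).app x = φ.app (x, op y) ≫ tensorι M' x y := by
  have h2 := MonoidalCategory.rightUnitor_inv_naturality (φ.app (x, op y))
  refine (Category.assoc _ _ _).trans (Eq.trans ?_ (Category.assoc _ _ _))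
  refine Eq.trans ?_ (h2.symm =≫ _)
  exact ((ρ_ (M.obj (x, op y))).inv ≫= coend.ι_map
    ((tensorBif (triv k C)).map ((Functor.curry.map φ).app x)) y).trans (Category.assoc _ _ _).symm

theorem tensorι_tensorMap_app_assoc (φ : M ⟶ M') (x y : C) {Z : ModuleCat.{u} k}
    (h : (tensorObj (triv k C) M').obj x ⟶ Z) :
    tensorι M x y ≫ (tensorMap (triv k C) φ).app x ≫ h = φ.app (x, op y) ≫ tensorι M' x y ≫ h :=
  comp_comp_eq_of_comp_eq (tensorι_tensorMap_app φ x y) h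

theorem tensorObj_hom_ext {x : C} {X : ModuleCat.{u} k}
    {f g : (tensorObj (triv k C) M).obj x ⟶ X} (h : ∀ y, tensorι M x y ≫ f = tensorι M x y ≫ g) :
    f = g :=
  coend.hom_ext fun y => (cancel_epi (ρ_ (M.obj (x, op y))).inv).1
    ((Category.assoc _ _ _).symm.trans ((h y).trans (Category.assoc _ _ _)))

/-- A morphism out of `(M ⊗_{kC} k)(x)`. -/
def tensorLift {x : C} {X : ModuleCat.{u} k} (f : ∀ y, M.obj (x, op y) ⟶ X)
    (hf : ∀ ⦃y y' : C⦄ (g : y ⟶ y'),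
      M.map (X := (x, op y')) (Y := (x, op y)) (𝟙 x, g.op) ≫ f y = f y') :
    (tensorObj (triv k C) M).obj x ⟶ X :=
  coend.desc (F := (tensorBif (triv k C)).obj ((Functor.curry.obj M).obj x))
    (fun y => (ρ_ (M.obj (x, op y))).hom ≫ f y) fun y y' g => by
    have h1 : (((tensorBif (triv k C)).obj ((Functor.curry.obj M).obj x)).obj (op y')).map g =
      𝟙 _ := MonoidalCategory.whiskerLeft_id _ _
    have h2 := MonoidalCategory.rightUnitor_naturality
      (M.map (X := (x, op y')) (Y := (x, op y)) (𝟙 x, g.op))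
    refine (Category.assoc _ _ _).symm.trans ((h2 =≫ _).trans ((Category.assoc _ _ _).trans ?_))
    refine ((ρ_ (M.obj (x, op y'))).hom ≫= hf g).trans ?_
    exact ((h1 =≫ _).trans (Category.id_comp _)).symm

theorem tensorι_tensorLift {x : C} {X : ModuleCat.{u} k} (f : ∀ y, M.obj (x, op y) ⟶ X)
    (hf : ∀ ⦃y y' : C⦄ (g : y ⟶ y'),
      M.map (X := (x, op y')) (Y := (x, op y)) (𝟙 x, g.op) ≫ f y = f y') (y : C) :
    tensorι M x y ≫ tensorLift f hf = f y :=
  (Category.assoc _ _ _).trans (((ρ_ (M.obj (x, op y))).inv ≫= coend.ι_desc _ _ y).trans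
    ((ρ_ (M.obj (x, op y))).inv_hom_id_assoc (f y)))

theorem natTrans_pr_condition {N : C ⥤ ModuleCat.{u} k} (g : M ⟶ FactCat.pr C ⋙ N) {x y y' : C}
    (h : y ⟶ y') :
    M.map (X := (x, op y')) (Y := (x, op y)) (𝟙 x, h.op) ≫ g.app (x, op y) =
      g.app (x, op y') :=
  (g.naturality (X := (x, op y')) (Y := (x, op y)) (𝟙 x, h.op)).trans
    ((g.app (x, op y') ≫= N.map_id x).trans (Category.comp_id _))

/-- The components of the morphism `M ⊗_{kC} k ⟶ N` adjoint to `g`. -/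
def tensorHomApp {N : C ⥤ ModuleCat.{u} k} (g : M ⟶ FactCat.pr C ⋙ N) (x : C) :
    (tensorObj (triv k C) M).obj x ⟶ N.obj x :=
  tensorLift (X := N.obj x) (fun y => g.app (x, op y)) fun _ _ h => natTrans_pr_condition g h

theorem tensorι_tensorHomApp {N : C ⥤ ModuleCat.{u} k} (g : M ⟶ FactCat.pr C ⋙ N) (x y : C) :
    tensorι M x y ≫ tensorHomApp g x = g.app (x, op y) :=
  tensorι_tensorLift _ _ y

theorem tensorι_tensorHomApp_assoc {N : C ⥤ ModuleCat.{u} k} (g : M ⟶ FactCat.pr C ⋙ N) (x y : C)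
    {Z : ModuleCat.{u} k} (h : N.obj x ⟶ Z) :
    tensorι M x y ≫ tensorHomApp g x ≫ h = g.app (x, op y) ≫ h :=
  comp_comp_eq_comp (tensorι_tensorHomApp g x y) h

variable (M) in
/-- Morphisms out of `M ⊗_{kC} k`. -/
def tensorHomEquiv (N : C ⥤ ModuleCat.{u} k) :
    (tensorObj (triv k C) M ⟶ N) ≃ (M ⟶ FactCat.pr C ⋙ N) where
  toFun f :=
    { app p := tensorι M p.1 p.2.unop ≫ f.app p.1
      naturality p q g := by
        obtain ⟨x, ⟨y⟩⟩ := p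
        obtain ⟨x', ⟨y'⟩⟩ := q
        -- The morphism is split into its two coordinates: `tensorι` is natural in the first and
        -- invariant under the second.
        have h : M.map g = M.map (X := (x, op y)) (Y := (x', op y)) (g.1, 𝟙 _) ≫
            M.map (X := (x', op y)) (Y := (x', op y')) (𝟙 x', g.2) := by
          rw [← M.map_comp]
          congr 1
          exact Prod.ext (Category.comp_id g.1).symm (Category.id_comp g.2).symm
        refine (h =≫ _).trans ((Category.assoc _ _ _).trans ?_)
        refine (_ ≫= tensorι_condition_assoc M x' g.2.unop (f.app x')).trans ?_
        refine (tensorι_map_assoc M g.1 y (f.app x')).symm.trans ?_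
        exact (tensorι M x y ≫= f.naturality g.1).trans (Category.assoc _ _ _).symm }
  invFun g :=
    { app := tensorHomApp g
      naturality x x' f := by
        refine tensorObj_hom_ext fun y => ?_
        refine (tensorι_map_assoc M f y _).trans ?_
        refine (_ ≫= tensorι_tensorHomApp g x' y).trans ?_
        exact (g.naturality (X := (x, op y)) (Y := (x', op y)) (f, 𝟙 _)).trans
          (tensorι_tensorHomApp_assoc g x y _).symm }
  left_inv f := by
    ext x : 2
    exact tensorObj_hom_ext fun y => tensorι_tensorLift (X := N.obj x)
      (fun y => tensorι M x y ≫ f.app x) (fun _ _ g => tensorι_condition_assoc M x g (f.app x)) y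
  right_inv g := by
    ext ⟨x, ⟨y⟩⟩ : 2
    exact tensorι_tensorHomApp g x y

variable (k C) in
/-- `- ⊗_{kC} k` is left adjoint to the restriction along the projection. -/
def tensorAdjunction : tensorOver (triv k C) ⊣
    (Functor.whiskeringLeft _ _ (ModuleCat.{u} k)).obj (FactCat.pr C) :=
  Adjunction.mkOfHomEquiv
    { homEquiv := tensorHomEquiv
      homEquiv_naturality_left_symm {M M' N} f g := by
        ext x : 2
        refine tensorObj_hom_ext fun y => ?_
        let g' : M' ⟶ FactCat.pr C ⋙ N := g
        refine (tensorι_tensorHomApp (f ≫ g') x y).trans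
          (Eq.trans ?_ (tensorι_tensorMap_app_assoc f x y _).symm)
        exact f.app _ ≫= (tensorι_tensorHomApp g' x y).symm
      homEquiv_naturality_right {M N N'} f g := by
        ext ⟨x, ⟨y⟩⟩ : 2
        exact (Category.assoc _ _ _).symm }

theorem tensorAdjunction_homEquiv (M : C × Cᵒᵖ ⥤ ModuleCat.{u} k) (N : C ⥤ ModuleCat.{u} k) :
    (tensorAdjunction k C).homEquiv M N = tensorHomEquiv M N :=
  congrFun (congrFun (Adjunction.mkOfHomEquiv_homEquiv _) M) N

theorem tensorHomEquiv_tensorDesc :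
    tensorHomEquiv (bimod k C) (triv k C) (tensorDesc (triv k C)) = unitPr k C := by
  ext ⟨x, ⟨y⟩⟩ : 2
  have h0 : coend.ι _ y ≫ (tensorDesc (triv k C)).app x = tensorAct (triv k C) x y :=
    coend.ι_desc (tensorAct (triv k C) x) (fun _ _ g => tensorAct_dinatural (triv k C) x g) y
  refine (Category.assoc _ _ _).trans
    (((ρ_ ((bimod k C).obj (x, op y))).inv ≫= h0).trans ?_)
  refine ModuleCat.hom_ext (Finsupp.lhom_ext' fun f => LinearMap.ext_ring ?_)
  have h : Finsupp.linearCombination k (fun _ : y ⟶ x => (LinearMap.id : k →ₗ[k] k))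
      (Finsupp.single f (1 : k)) (1 : k) =
    Finsupp.linearCombination k (fun _ : y ⟶ x => (1 : k)) (Finsupp.single f (1 : k)) := by
    simp
  exact h

theorem tensorAdjunction_homEquiv_tensorDesc :
    (tensorAdjunction k C).homEquiv (bimod k C) (triv k C) (tensorDesc (triv k C)) =
      unitPr k C := by
  rw [tensorAdjunction_homEquiv]
  exact tensorHomEquiv_tensorDesc

/-- The relation along `f : y ⟶ x` identifies the class of `f` with that of `𝟙 x`, so the colimit of
`k Hom(-, x)` is the line spanned by the class of `𝟙 x`. The inverse sends `1` to this class. -/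
theorem isIso_tensorDesc : IsIso (tensorDesc (triv k C)) := by
  have hι (x y : C) : tensorι (bimod k C) x y ≫ (tensorDesc (triv k C)).app x =
      (unitPr k C).app (x, op y) :=
    congrArg (fun f : bimod k C ⟶ FactCat.pr C ⋙ triv k C => f.app (x, op y))
      tensorHomEquiv_tensorDesc
  rw [NatTrans.isIso_iff_isIso_app]
  intro x
  let e : ModuleCat.of k k ⟶ (bimod k C).obj (x, op x) :=
    ModuleCat.ofHom (LinearMap.toSpanSingleton k ((x ⟶ x) →₀ k) (Finsupp.single (𝟙 x) 1))
  refine ⟨e ≫ tensorι (bimod k C) x x, tensorObj_hom_ext fun y => ?_, ?_⟩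
  · refine (Category.assoc _ _ _).symm.trans ((hι x y =≫ _).trans
      (Eq.trans ?_ (Category.comp_id _).symm))
    refine ModuleCat.hom_ext (Finsupp.lhom_ext' fun f => LinearMap.ext_ring ?_)
    have h1 : (unitPr k C).app (x, op y) (Finsupp.single f (1 : k)) = (1 : k) :=
      (Finsupp.linearCombination_single k (1 : k) f).trans (one_smul k _)
    have h2 : e (1 : k) = Finsupp.single (𝟙 x) (1 : k) := one_smul k _
    have h3 : (bimod k C).map (X := (x, op x)) (Y := (x, op y)) (𝟙 x, f.op)
        (Finsupp.single (𝟙 x) (1 : k)) = Finsupp.single f (1 : k) := by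
      refine (Finsupp.mapDomain_single (f := fun h : x ⟶ x => f ≫ h ≫ 𝟙 x)).trans ?_
      simp
    have h4 := congrArg (fun g => g.hom (Finsupp.single (𝟙 x) (1 : k)))
      (tensorι_condition (bimod k C) x f)
    refine (congrArg (fun z => tensorι (bimod k C) x x (e z)) h1).trans ?_
    refine (congrArg (tensorι (bimod k C) x x) h2).trans ?_
    refine h4.symm.trans ?_
    exact congrArg (tensorι (bimod k C) x y) h3
  · refine (Category.assoc _ _ _).trans ((e ≫= hι x x).trans ?_)
    refine ModuleCat.hom_ext (LinearMap.ext_ring ?_)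
    exact (congrArg ((unitPr k C).app (x, op x)) (one_smul k _)).trans
      ((Finsupp.linearCombination_single k (1 : k) (𝟙 x)).trans (one_smul k _))

end Tensor

end TensorTrivial

section TensorTrivialAcyclic

variable {k : Type u} [Field k] {C : Type u} [SmallCategory C]

/-! ### Exactness of `- ⊗_{kC} k` on projective resolutions of `kC` -/

section TensorAcyclic

variable (k) in
/-- The functor `M ↦ M(x, -)`. -/
def sliceFunctor (x : C) : (C × Cᵒᵖ ⥤ ModuleCat.{u} k) ⥤ (Cᵒᵖ ⥤ ModuleCat.{u} k) :=
  Functor.curry ⋙ (evaluation C (Cᵒᵖ ⥤ ModuleCat.{u} k)).obj x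

variable (k) in
/-- The right adjoint of `sliceFunctor`. -/
def sliceRightAdjoint (x : C) : (Cᵒᵖ ⥤ ModuleCat.{u} k) ⥤ (C × Cᵒᵖ ⥤ ModuleCat.{u} k) :=
  evaluationRightAdjoint (Cᵒᵖ ⥤ ModuleCat.{u} k) x ⋙ Functor.uncurry

variable (k) in
/-- The adjunction between `sliceFunctor` and `sliceRightAdjoint`. -/
def sliceAdjunction (x : C) : sliceFunctor k x ⊣ sliceRightAdjoint k x :=
  Functor.currying.symm.toAdjunction.comp (evaluationAdjunctionLeft (Cᵒᵖ ⥤ ModuleCat.{u} k) x)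

/-- The value at `y` is a product of copies indexed by `y ⟶ x`, and products of functors to vector
spaces preserve epimorphisms. It follows that `sliceFunctor` preserves projectives. -/
instance (x : C) : (evaluationRightAdjoint (Cᵒᵖ ⥤ ModuleCat.{u} k) x).PreservesEpimorphisms where
  preserves {X Y} φ _ := (NatTrans.epi_iff_epi_app _).2 fun y => by
    have : Epi (Discrete.natTrans (F := Discrete.functor fun _ : y ⟶ x => X)
      (G := Discrete.functor fun _ : y ⟶ x => Y)
      fun _ => φ) := (NatTrans.epi_iff_epi_app _).2 fun _ => ‹Epi φ›
    have h : Epi (lim.map (Discrete.natTrans (F := Discrete.functor fun _ : y ⟶ x => X)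
      (G := Discrete.functor fun _ : y ⟶ x => Y)
      fun _ => φ)) := lim.map_epi _
    exact h

instance (x : C) : (sliceRightAdjoint k x).PreservesEpimorphisms where
  preserves φ _ := (NatTrans.epi_iff_epi_app _).2 fun p =>
    (NatTrans.epi_iff_epi_app _).1 ((NatTrans.epi_iff_epi_app _).1 (inferInstance : Epi
      ((evaluationRightAdjoint (Cᵒᵖ ⥤ ModuleCat.{u} k) x).map φ)) p.1) p.2

instance (x : C) : (sliceFunctor k x).IsLeftAdjoint := (sliceAdjunction k x).isLeftAdjoint

instance (x : C) : (sliceFunctor k x).Additive where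
  map_add := rfl

instance (x : C) : (sliceFunctor k x).PreservesMonomorphisms where
  preserves φ _ := (NatTrans.mono_iff_mono_app _).2 fun y =>
    inferInstanceAs (Mono (φ.app (x, y)))

instance (x : C) : (sliceFunctor k x).PreservesHomology :=
  (sliceFunctor k x).preservesHomology_of_preservesMonos_and_cokernels

/-- By Yoneda, a map out of `k Hom(-, x)` is an element at `x`. Lifting `f` through `e` amounts to
choosing a preimage `z` of the image of `𝟙 x`; the lift sends `α` to `E(α)(z)`. -/
instance (x : C) : Projective ((sliceFunctor k x).obj (bimod k C)) where
  factors {E X} f e _ := by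
    have he : Epi (e.app (op x)) := (NatTrans.epi_iff_epi_app e).1 ‹_› _
    obtain ⟨z, hz⟩ := (ModuleCat.epi_iff_surjective _).1 he
      (f.app (op x) (Finsupp.single (𝟙 x) (1 : k)))
    have hmap {y y' : C} (α : y ⟶ x) (g : y' ⟶ y) :
        ((sliceFunctor k x).obj (bimod k C)).map g.op (Finsupp.single α (1 : k)) =
          Finsupp.single (g ≫ α) (1 : k) := by
      refine (Finsupp.mapDomain_single (f := fun h : y ⟶ x => g ≫ h ≫ 𝟙 x)).trans ?_
      simp
    refine ⟨{ app y := ModuleCat.ofHom (linearCombinationTo (E.obj y)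
                fun α : y.unop ⟶ x => E.map α.op z)
              naturality := ?_ }, ?_⟩
    · rintro ⟨y⟩ ⟨y'⟩ g
      refine ModuleCat.hom_ext (Finsupp.lhom_ext' fun α => LinearMap.ext_ring ?_)
      refine (congrArg (linearCombinationTo (E.obj (op y')) _) (hmap α g.unop)).trans ?_
      refine (linearCombinationTo_single _ _ _).trans ?_
      refine Eq.trans ?_ (congrArg (E.map g) (linearCombinationTo_single _ _ α)).symm
      have := E.map_comp (Quiver.Hom.op α) g
      exact congrArg (fun h => h z) this
    · ext ⟨y⟩ : 2
      refine ModuleCat.hom_ext (Finsupp.lhom_ext' fun α => LinearMap.ext_ring ?_)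
      refine (congrArg (e.app (op y)) (linearCombinationTo_single _ _ α)).trans ?_
      refine (congrArg (fun h => h z) (e.naturality (Quiver.Hom.op α))).trans ?_
      refine (congrArg (X.map (Quiver.Hom.op α)) hz).trans ?_
      have h1 := congrArg (fun h => h (Finsupp.single (𝟙 x) (1 : k)))
        (f.naturality (Quiver.Hom.op α))
      refine h1.symm.trans (congrArg (f.app (op y)) ?_)
      refine (hmap (𝟙 x) α).trans ?_
      rw [Category.comp_id]
      rfl

variable (k C) in
/-- The functor `X ↦ X ⊗_{kC} k` on right modules. -/
def coendFunctor : (Cᵒᵖ ⥤ ModuleCat.{u} k) ⥤ ModuleCat.{u} k :=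
  tensorBif (triv k C) ⋙ Limits.coendFunctor C (ModuleCat.{u} k)

instance : (coendFunctor k C).Additive where
  map_add {X Y f g} := by
    refine coend.hom_ext fun y => ?_
    refine (coend.ι_map _ _).trans ?_
    refine Eq.trans ?_ (Preadditive.comp_add _ _ _ _ _ _).symm
    refine Eq.trans ?_ (congrArg₂ (· + ·) (coend.ι_map _ y) (coend.ι_map _ y)).symm
    refine Eq.trans ?_ (Preadditive.add_comp _ _ _ _ _ _)
    exact MonoidalPreadditive.add_whiskerRight _ _ =≫ _

/-- At `x`, the functor is `M ↦ M(x, -)`, which is exact and preserves projectives, followed by an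
additive coend functor. As `kC(x, -)` is projective, `comp_of_projective` applies. -/
theorem isAcyclicAt_tensorOver : IsAcyclicAt (tensorOver (triv k C)) (bimod k C) :=
  IsAcyclicAt.of_evaluation fun x =>
    (IsAcyclicAt.comp_of_projective (G := coendFunctor k C) (sliceAdjunction k x)
      (IsAcyclicAt.of_exact (M := bimod k C))).of_iso (NatIso.ofComponents fun M => Iso.refl _)

end TensorAcyclic

end TensorTrivialAcyclic

/-! ### Independence of the left adjoint and compatibility with composition -/

theorem isIso_homEquiv_symm_of_isIso {A B : Type*} [Category A] [Category B] {L L' : A ⥤ B}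
    {R : B ⥤ A} {M : A} {M' : B} (adj : L ⊣ R) (adj' : L' ⊣ R) (m : L.obj M ⟶ M') [IsIso m] :
    IsIso ((adj'.homEquiv M M').symm (adj.homEquiv M M' m)) := by
  have h : (adj'.homEquiv M M').symm (adj.homEquiv M M' m) =
      (adj'.leftAdjointUniq adj).hom.app M ≫ m := by
    rw [Equiv.symm_apply_eq, adj'.homEquiv_naturality_right,
      Adjunction.homEquiv_leftAdjointUniq_hom_app, adj.homEquiv_unit]
  rw [h]
  infer_instance

section Transfer

variable {A B D : Type*} [Category A] [Abelian A] [Category B] [Abelian B] [Category D] [Abelian D]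
  {L L' : A ⥤ B} {R : B ⥤ A} {M : A} {M' : B}

variable [HasExt.{u} A] [HasExt.{u} B] [L.PreservesZeroMorphisms] [L'.PreservesZeroMorphisms]
  [R.Additive] [PreservesFiniteLimits R] [PreservesFiniteColimits R]

theorem bijective_extRestrict_of_isAcyclicAt [EnoughProjectives A] (adj : L ⊣ R)
    (m : L.obj M ⟶ M') [IsIso m] (h : IsAcyclicAt L M) {j : M ⟶ R.obj M'}
    (hj : adj.homEquiv M M' m = j) (n : ℕ) : Function.Bijective (extRestrict R j M' n) := by
  obtain rfl : m = (adj.homEquiv M M').symm j := ((Equiv.symm_apply_eq _).2 hj.symm).symm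
  exact extRestrict_bijective adj (ProjectiveResolution.of M)
    (h.quasiIso_augmentation _ _) inferInstance M' n

/-- Exactness is verified on a convenient left adjoint `L` and carried to any other `L'`, in
particular to `lan`, by uniqueness of left adjoints. -/
theorem isInducedBy_of_leftAdjoint (k : Type u) [Field k] [Linear k A] [Linear k B] [R.Linear k]
    (adj : L ⊣ R) (m : L.obj M ⟶ M') [IsIso m] (h : IsAcyclicAt L M) {j : M ⟶ R.obj M'}
    (hm : adj.homEquiv M M' m = j) (hj : ∀ n, Function.Bijective (extRestrict.{u} R j M' n))
    (adj' : L' ⊣ R) :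
    IsInducedBy L' ((adj'.homEquiv M M').symm j) (inducedAlgHom k hj) := by
  have : IsIso ((adj'.homEquiv M M').symm j) := by
    rw [← hm]
    exact isIso_homEquiv_symm_of_isIso adj adj' m
  exact isInducedBy_inducedAlgHom k hj adj' _ (Equiv.apply_symm_apply _ _)
    fun P => (h.of_iso (adj.leftAdjointUniq adj')).quasiIso_augmentation _ P

variable {L₁ : A ⥤ B} {L₂ : B ⥤ D} {R₁ : B ⥤ A} {R₂ : D ⥤ B} {M'' : D} [HasExt.{u} D]
  [L₁.PreservesZeroMorphisms] [L₂.PreservesZeroMorphisms]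

/-- The maps induced by left adjoints are compatible with composition. -/
theorem IsInducedBy.comp_apply [EnoughProjectives A] (adj₁ : L₁ ⊣ R₁) (adj₂ : L₂ ⊣ R₂)
    [R₁.PreservesEpimorphisms] [R₂.PreservesEpimorphisms]
    {m₁ : L₁.obj M ⟶ M'} {m₂ : L₂.obj M' ⟶ M''}
    {Φ₁ : ExtAlg.{u} M → ExtAlg.{u} M'} {Φ₂ : ExtAlg.{u} M' → ExtAlg.{u} M''}
    {Φ : ExtAlg.{u} M → ExtAlg.{u} M''} (h₁ : IsInducedBy L₁ m₁ Φ₁) (h₂ : IsInducedBy L₂ m₂ Φ₂)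
    (h : IsInducedBy (L₁ ⋙ L₂) (L₂.map m₁ ≫ m₂) Φ) (h0 : Φ 0 = 0) (h0₁ : Φ₁ 0 = 0)
    (h0₂ : Φ₂ 0 = 0) (x : ExtAlg.{u} M) : Φ x = Φ₂ (Φ₁ x) := by
  induction x using DirectSum.induction_on with
  | zero => rw [h0, h0₁, h0₂]
  | add x y hx hy => rw [h.map_add, h₁.map_add, h₂.map_add, hx, hy]
  | of n x =>
    -- With the resolutions `P`, `L₁(P)` and `L₂(L₁(P))`, every comparison chain map can be taken to
    -- be an identity.
    let P := ProjectiveResolution.of M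
    let P₁ := mapResolution adj₁ m₁ P (h₁.quasiIso P)
    let P₂ := mapResolution adj₂ m₂ P₁ (h₂.quasiIso P₁)
    obtain ⟨f, hf, rfl⟩ := P.extMk_surjective x (n + 1) rfl
    have e₁ := h₁.map_class P P₁ (𝟙 _) (Category.id_comp _) n f hf
    have e₂ := h₂.map_class P₁ P₂ (𝟙 _) (Category.id_comp _) n
      ((𝟙 P₁.complex : P₁.complex ⟶ P₁.complex).f n ≫ L₁.map f ≫ m₁)
      (induced_cocycle L₁ (P := P) (Q := P₁) m₁ (𝟙 _) hf)
    let c : P₂.complex ⟶ ((L₁ ⋙ L₂).mapHomologicalComplex (ComplexShape.down ℕ)).obj P.complex :=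
      𝟙 P₂.complex
    have hc : c ≫ augmentation (L₁ ⋙ L₂) (L₂.map m₁ ≫ m₂) P = P₂.π := by
      refine HomologicalComplex.to_single_hom_ext ?_
      refine (Category.id_comp _).trans ((augmentation_f_zero (L := L₁ ⋙ L₂) _ P).trans
        (Eq.trans ?_ (augmentation_f_zero m₂ P₁).symm))
      refine Eq.trans ?_ ((congrArg L₂.map (augmentation_f_zero m₁ P)).symm =≫ m₂)
      have h3 {X : A} (p : X ⟶ M) : (L₁ ⋙ L₂).map p ≫ L₂.map m₁ ≫ m₂ =
          L₂.map (L₁.map p ≫ m₁) ≫ m₂ := by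
        rw [L₂.map_comp, Category.assoc, Functor.comp_map]
      exact h3 (P.π.f 0)
    have e := h.map_class P P₂ c hc n f hf
    refine e.trans (Eq.trans ?_ ((congrArg Φ₂ e₁).trans e₂).symm)
    congr 2
    change 𝟙 (L₂.obj (L₁.obj (P.complex.X n))) ≫ L₂.map (L₁.map f) ≫ L₂.map m₁ ≫ m₂ =
      𝟙 (L₂.obj (L₁.obj (P.complex.X n))) ≫
        L₂.map (𝟙 (L₁.obj (P.complex.X n)) ≫ L₁.map f ≫ m₁) ≫ m₂
    rw [Category.id_comp, Category.id_comp, Category.id_comp, L₂.map_comp, Category.assoc]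

end Transfer

/-! ### Homogeneity of preimages -/

section InverseGraded

variable {A B : Type*} [Category A] [Abelian A] [Category B] [Abelian B]
  [HasExt.{u} A] [HasExt.{u} B] (k : Type u) [Field k] [Linear k A] [Linear k B]
  {R : B ⥤ A} [R.Additive] [PreservesFiniteLimits R] [PreservesFiniteColimits R] [R.Linear k]
  {M : A} {M' : B} {j : M ⟶ R.obj M'} (hj : ∀ n, Function.Bijective (extRestrict.{u} R j M' n))

/-- The class `j⁻¹ ∘ R(y) ∘ j` is a preimage of degree `n`, and injectivity makes it the only one.
This shows that `(t^*)⁻¹` is graded. -/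
theorem exists_of_inducedAlgHom_eq_homog [IsIso j] {x : ExtAlg.{u} M} {n : ℕ}
    {y : Ext.{u} M' M' n} (h : inducedAlgHom k hj x = homog n y) : ∃ z, x = homog n z := by
  refine ⟨(extRestrict R j M' n y).comp (Ext.mk₀ (inv j)) (add_zero n),
    (bijective_inducedAlgHom k hj).1 ?_⟩
  rw [h, inducedAlgHom_homog]
  congr 1
  symm
  rw [extInduced_eq_iff, Ext.comp_assoc _ _ _ (add_zero n) (zero_add 0) (by omega),
    Ext.mk₀_comp_mk₀, IsIso.inv_hom_id, Ext.comp_mk₀_id]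

end InverseGraded

/-! ### The three adjunctions and the induced algebra homomorphisms -/

section Main

variable (k : Type u) [Field k] (C : Type u) [SmallCategory C]

/-- The composite of the left adjoints of the restrictions along `τ` and `pr` is left adjoint to
the restriction along `t`. -/
def sumTauTensorAdjunction : FactCat.sumTau k C ⋙ tensorOver (triv k C) ⊣
    (Functor.whiskeringLeft _ _ (ModuleCat.{u} k)).obj (FactCat.t C) :=
  (FactCat.sumTauAdjunction k C).comp (tensorAdjunction k C)

theorem sumTauAdjunction_homEquiv_sumTauDesc :
    (FactCat.sumTauAdjunction k C).homEquiv (triv k (FactCat C)) (bimod k C)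
      (FactCat.sumTauDesc k C) = unitTau k C := by
  have h : (FactCat.sumTauAdjunction k C).homEquiv (triv k (FactCat C)) (bimod k C) =
      FactCat.sumTauHomEquiv (triv k (FactCat C)) (bimod k C) :=
    congrFun (congrFun (Adjunction.mkOfHomEquiv_homEquiv _) _) _
  rw [h]
  exact Equiv.apply_symm_apply _ _

/-- The canonical map `LK_pr(LK_τ(k)) ⟶ k`. -/
def sumTauTensorDesc :
    (FactCat.sumTau k C ⋙ tensorOver (triv k C)).obj (triv k (FactCat C)) ⟶ triv k C :=
  (tensorOver (triv k C)).map (FactCat.sumTauDesc k C) ≫ tensorDesc (triv k C)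

/-- At `[α]`, `1` goes to `α` and then back to `1`. This compatibility of the units lies behind `t^*
= pr^* τ^*`. -/
theorem unitTau_comp_unitPr : unitTau k C ≫ ((Functor.whiskeringLeft _ _ (ModuleCat.{u} k)).obj
    (FactCat.τ C)).map (unitPr k C) = unitT k C := by
  ext a : 2
  refine ModuleCat.hom_ext (LinearMap.ext_ring ?_)
  exact (congrArg ((unitPr k C).app (a.tgt, op a.src)) (one_smul k _)).trans
      ((Finsupp.linearCombination_single k (1 : k) a.arr).trans (one_smul k _))

theorem sumTauTensorAdjunction_homEquiv_sumTauTensorDesc :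
    (sumTauTensorAdjunction k C).homEquiv (triv k (FactCat C)) (triv k C)
      (sumTauTensorDesc k C) = unitT k C := by
  refine (congrFun (congrArg DFunLike.coe (congrFun (congrFun (Adjunction.comp_homEquiv
    (FactCat.sumTauAdjunction k C) (tensorAdjunction k C)) (triv k (FactCat C))) (triv k C))) _).trans ?_
  refine (congrArg ((FactCat.sumTauAdjunction k C).homEquiv _ _)
    (((tensorAdjunction k C).homEquiv_naturality_left (FactCat.sumTauDesc k C)
      (tensorDesc (triv k C))).trans
      (FactCat.sumTauDesc k C ≫= tensorAdjunction_homEquiv_tensorDesc))).trans ?_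
  refine ((FactCat.sumTauAdjunction k C).homEquiv_naturality_right (FactCat.sumTauDesc k C)
    (unitPr k C)).trans ?_
  refine (sumTauAdjunction_homEquiv_sumTauDesc k C =≫ _).trans ?_
  exact unitTau_comp_unitPr k C

instance : IsIso (FactCat.sumTauDesc k C) := FactCat.isIso_sumTauDesc

instance : IsIso (tensorDesc (triv k C)) := isIso_tensorDesc

instance : IsIso (sumTauTensorDesc k C) := by
  unfold sumTauTensorDesc
  infer_instance

theorem isAcyclicAt_sumTau : IsAcyclicAt (FactCat.sumTau k C) (triv k (FactCat C)) :=
  .of_exact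

/-- The first functor carries resolutions of `k` to resolutions of `kC`, on which the second stays
exact. -/
theorem isAcyclicAt_sumTauTensor :
    IsAcyclicAt (FactCat.sumTau k C ⋙ tensorOver (triv k C)) (triv k (FactCat C)) :=
  (isAcyclicAt_sumTau k C).comp (FactCat.sumTauAdjunction k C) (FactCat.sumTauDesc k C)
    isAcyclicAt_tensorOver

instance : IsIso (unitT k C) :=
  (NatTrans.isIso_iff_isIso_app _).2 fun _ => inferInstanceAs (IsIso (𝟙 (ModuleCat.of k k)))

theorem bijective_extRestrict_unitTau (n : ℕ) : Function.Bijective (extRestrict.{u}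
    ((Functor.whiskeringLeft _ _ (ModuleCat.{u} k)).obj (FactCat.τ C)) (unitTau k C)
      (bimod k C) n) :=
  bijective_extRestrict_of_isAcyclicAt (FactCat.sumTauAdjunction k C) (FactCat.sumTauDesc k C)
    (isAcyclicAt_sumTau k C) (sumTauAdjunction_homEquiv_sumTauDesc k C) n

theorem bijective_extRestrict_unitPr (n : ℕ) : Function.Bijective (extRestrict.{u}
    ((Functor.whiskeringLeft _ _ (ModuleCat.{u} k)).obj (FactCat.pr C)) (unitPr k C)
      (triv k C) n) :=
  bijective_extRestrict_of_isAcyclicAt (tensorAdjunction k C) (tensorDesc (triv k C))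
    isAcyclicAt_tensorOver tensorAdjunction_homEquiv_tensorDesc n

theorem bijective_extRestrict_unitT (n : ℕ) : Function.Bijective (extRestrict.{u}
    ((Functor.whiskeringLeft _ _ (ModuleCat.{u} k)).obj (FactCat.t C)) (unitT k C)
      (triv k C) n) :=
  bijective_extRestrict_of_isAcyclicAt (sumTauTensorAdjunction k C) (sumTauTensorDesc k C)
    (isAcyclicAt_sumTauTensor k C) (sumTauTensorAdjunction_homEquiv_sumTauTensorDesc k C) n

/-- The algebra homomorphism `τ^*`. -/
def tauAlgHom : ExtAlg (triv k (FactCat C)) →ₐ[k] ExtAlg (bimod k C) :=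
  inducedAlgHom k (bijective_extRestrict_unitTau k C)

/-- The algebra homomorphism `pr^*`. -/
def prAlgHom : ExtAlg (bimod k C) →ₐ[k] ExtAlg (triv k C) :=
  inducedAlgHom k (bijective_extRestrict_unitPr k C)

/-- The algebra isomorphism `t^*`. -/
def tAlgEquiv : ExtAlg (triv k (FactCat C)) ≃ₐ[k] ExtAlg (triv k C) :=
  AlgEquiv.ofBijective (inducedAlgHom k (bijective_extRestrict_unitT k C))
    (bijective_inducedAlgHom k (bijective_extRestrict_unitT k C))

theorem isInducedBy_tauAlgHom :
    IsInducedBy (FactCat.τ C).lan (lanDesc (FactCat.τ C) (unitTau k C)) (tauAlgHom k C) :=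
  isInducedBy_of_leftAdjoint k (FactCat.sumTauAdjunction k C) (FactCat.sumTauDesc k C)
    (isAcyclicAt_sumTau k C) (sumTauAdjunction_homEquiv_sumTauDesc k C) _
    ((FactCat.τ C).lanAdjunction (ModuleCat.{u} k))

theorem isInducedBy_tAlgEquiv :
    IsInducedBy (FactCat.t C).lan (lanDesc (FactCat.t C) (unitT k C)) (tAlgEquiv k C) :=
  isInducedBy_of_leftAdjoint k (sumTauTensorAdjunction k C) (sumTauTensorDesc k C)
    (isAcyclicAt_sumTauTensor k C) (sumTauTensorAdjunction_homEquiv_sumTauTensorDesc k C) _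
    ((FactCat.t C).lanAdjunction (ModuleCat.{u} k))

theorem isInducedBy_prAlgHom_lan :
    IsInducedBy (FactCat.pr C).lan (lanDesc (FactCat.pr C) (unitPr k C)) (prAlgHom k C) :=
  isInducedBy_of_leftAdjoint k (tensorAdjunction k C) (tensorDesc (triv k C))
    isAcyclicAt_tensorOver tensorAdjunction_homEquiv_tensorDesc _
    ((FactCat.pr C).lanAdjunction (ModuleCat.{u} k))

/-- The functor `- ⊗_{kC} k` is itself a left adjoint of restriction along `pr`, with the same unit
`unitPr`, so `φ_C` and `pr^*` are one homomorphism. -/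
theorem isInducedBy_prAlgHom_tensorOver :
    IsInducedBy (tensorOver (triv k C)) (tensorDesc (triv k C)) (prAlgHom k C) :=
  isInducedBy_inducedAlgHom k _ (tensorAdjunction k C) _ tensorAdjunction_homEquiv_tensorDesc
    (isAcyclicAt_tensorOver.quasiIso_augmentation _)

/-- As `t^*` does not depend on the left adjoint chosen, the composite `LK_pr ∘ LK_τ` computes it.
-/
theorem tAlgEquiv_apply (x : ExtAlg (triv k (FactCat C))) :
    tAlgEquiv k C x = prAlgHom k C (tauAlgHom k C x) :=
  IsInducedBy.comp_apply (Φ₁ := tauAlgHom k C) (Φ₂ := prAlgHom k C) (Φ := tAlgEquiv k C)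
    (FactCat.sumTauAdjunction k C) (tensorAdjunction k C)
    (isInducedBy_inducedAlgHom k _ (FactCat.sumTauAdjunction k C) (FactCat.sumTauDesc k C)
      (sumTauAdjunction_homEquiv_sumTauDesc k C)
      ((isAcyclicAt_sumTau k C).quasiIso_augmentation _))
    (isInducedBy_prAlgHom_tensorOver k C)
    (isInducedBy_inducedAlgHom k _ (sumTauTensorAdjunction k C) (sumTauTensorDesc k C)
      (sumTauTensorAdjunction_homEquiv_sumTauTensorDesc k C)
      ((isAcyclicAt_sumTauTensor k C).quasiIso_augmentation _))
    (map_zero _) (map_zero _) (map_zero _) x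

theorem isGraded_tAlgEquiv_symm : IsGraded (tAlgEquiv k C).symm := fun n y =>
  exists_of_inducedAlgHom_eq_homog k (bijective_extRestrict_unitT k C)
    ((tAlgEquiv k C).apply_symm_apply (homog n y))

end Main

theorem IsGraded.comp {A B D : Type*} [Category A] [Abelian A] [HasExt.{u} A] [Category B]
    [Abelian B] [HasExt.{u} B] [Category D] [Abelian D] [HasExt.{u} D] {M : A} {M' : B} {M'' : D}
    {Ψ : ExtAlg.{u} M' → ExtAlg.{u} M''} {Φ : ExtAlg.{u} M → ExtAlg.{u} M'} (hΨ : IsGraded Ψ)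
    (hΦ : IsGraded Φ) : IsGraded (Ψ ∘ Φ) := fun n x => by
  obtain ⟨y, hy⟩ := hΦ n x
  obtain ⟨z, hz⟩ := hΨ n y
  exact ⟨z, (congrArg Ψ hy).trans hz⟩

end CatCohomology

end

/-! ### The splitting of `φ_C` -/

open CatCohomology

theorem theorem2p3p1 (C : Type u) [SmallCategory C] (k : Type u) [Field k] :
    ∃ (tauStar : ExtAlg (triv k (FactCat C)) →ₐ[k] ExtAlg (bimod k C))
      (tStar : ExtAlg (triv k (FactCat C)) ≃ₐ[k] ExtAlg (triv k C))
      (prStar phi : ExtAlg (bimod k C) →ₐ[k] ExtAlg (triv k C))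
      (epsStar : ExtAlg (bimod k C) →ₐ[k] ExtAlg (triv k (FactCat C))),
      -- the maps `τ^*`, `t^*`, `pr^*` induced by left Kan extension
      IsInducedBy (FactCat.τ C).lan (lanDesc (FactCat.τ C) (unitTau k C)) tauStar ∧
      IsInducedBy (FactCat.t C).lan (lanDesc (FactCat.t C) (unitT k C)) tStar ∧
      IsInducedBy (FactCat.pr C).lan (lanDesc (FactCat.pr C) (unitPr k C)) prStar ∧
      -- the map `φ_C` induced by `- ⊗_{kC} k`
      IsInducedBy (tensorOver (triv k C)) (tensorDesc (triv k C)) phi ∧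
      IsGraded epsStar ∧
      epsStar.comp tauStar = AlgHom.id k _ ∧
      (tStar : _ →ₐ[k] _).comp epsStar = prStar ∧
      prStar = phi ∧
      Function.Surjective phi ∧
      ∃ σ : ExtAlg (triv k C) →ₐ[k] ExtAlg (bimod k C),
        IsGraded σ ∧ phi.comp σ = AlgHom.id k _ := by
  have hφ (y : ExtAlg (triv k C)) :
      prAlgHom k C (tauAlgHom k C ((tAlgEquiv k C).symm y)) = y := by
    rw [← tAlgEquiv_apply, AlgEquiv.apply_symm_apply]
  -- The witnesses are `φ_C = pr^*`, `ε^* = (t^*)⁻¹ pr^*` and `σ = τ^* (t^*)⁻¹`; every identity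
  -- follows from `t^* = pr^* τ^*`.
  refine ⟨tauAlgHom k C, tAlgEquiv k C, prAlgHom k C, prAlgHom k C,
    (tAlgEquiv k C).symm.toAlgHom.comp (prAlgHom k C), isInducedBy_tauAlgHom k C,
    isInducedBy_tAlgEquiv k C, isInducedBy_prAlgHom_lan k C,
    isInducedBy_prAlgHom_tensorOver k C,
    (isGraded_tAlgEquiv_symm k C).comp
      (isGraded_inducedAlgHom k (bijective_extRestrict_unitPr k C)),
    AlgHom.ext fun x => ?_, AlgHom.ext fun x => (tAlgEquiv k C).apply_symm_apply _, rfl,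
    fun y => ⟨_, hφ y⟩, (tauAlgHom k C).comp (tAlgEquiv k C).symm.toAlgHom,
    (isGraded_inducedAlgHom k (bijective_extRestrict_unitTau k C)).comp
      (isGraded_tAlgEquiv_symm k C), AlgHom.ext hφ⟩
  exact (congrArg (tAlgEquiv k C).symm (tAlgEquiv_apply k C x).symm).trans
    ((tAlgEquiv k C).symm_apply_apply x)
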